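/- **Notation.** Let $d\ge 1$, $p\in(1,\infty)$, $q$ the Hölder conjugate of $p$, $\sigma_2:\mathbb R\to\mathbb R$ Lipschitz, $\lambda\in(0,1)$, $M\in\mathbb R$. Let $D_d\subset\mathbb R^d$ satisfy $\|u\|\le M$ for all $u\in D_d$, and let $\mathcal I_d\subset (D_d)^{\mathbb Z_-}$, where $\mathbb Z_-=\{0,-1,-2,\dots\}$. Put $\mathcal X=\mathbb R\times\ell^p\times\mathbb R^d\times\mathbb R$ and $\mathcal X^N=\mathbb R\times\mathbb R^N\times\mathbb R^d\times\mathbb R$, with points $(w,a,c,b)$, and write $a\cdot x=\sum_i a_ix_i$. Norms on $\mathbb R^n$ are Euclidean and $|||\cdot|||$ denotes operator norms. **Target.** Let $A:\ell^q\to\ell^q$ and $C:\mathbb R^d\to\ell^q$ be bounded and linear with $|||A|||<\lambda$, let $B\in\ell^q$, and let $\mu$ be a Borel probability measure on $\mathcal X$ with $I_{\mu,p}=\int|w|(\|a\|_p+\|c\|+|b|)\,d\mu<\infty$, $I^{(2)}_{\mu,p}=\big(\int w^2(\|a\|_p^2+\|c\|^2+|b|^2+1)\,d\mu\big)^{1/2}<\infty$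 and $\int(|w|+\|a\|_p+\|c\|+|b|)\,d\mu<\infty$. Let $H:\mathcal I_d\to\mathbb R$ be the recurrent Barron functional $H(z)=\int w\,\sigma_2(a\cdot x_{-1}(z)+c\cdot z_0+b)\,d\mu$, where $(x_t(z))_{t\le 0}$ is the unique bounded solution in $\ell^q$ of $x_t=Ax_{t-1}+Cz_t+B$, $t\le 0$. **Approximant.** Let $N\ge1$, $A^{E}\in\mathbb R^{N\times N}$, $B^{E}\in\mathbb R^N$, $C^{E}\in\mathbb R^{N\times d}$ with $|||A^{E}|||<1$, and let $K\in\mathbb R^{N\times N}$, the first $N$ columns of $(C^{E}\,|\,A^{E}C^{E}\,|\,(A^{E})^2C^{E}\,|\cdots)$, be invertible. Let $x^{E}(z)$ be the bounded solution of $x^{E}_t=A^{E}x^{E}_{t-1}+C^{E}z_t+B^{E}$, $t\le 0$. For hidden weights $V_i=(w^{(i)},a^{(i)},c^{(i)},b_i)\in\mathcal X^N$, $i=1,\dots,N$, and a readout $W\in\mathbb R^N$ put $\widehat H(z)=\sum_{i=1}^N W_i\,\sigma_2(a^{(i)}\cdot x^{E}_{-1}(z)+c^{(i)}\cdot z_0+b_i)$.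 **Induced measure.** Let $T=\lceil N/d\rceil$, let $\Lambda$ be the diagonal $N\times N$ matrix with entry $\lambda^{k-1}$ at position $d(k-1)+j$ ($k\ge1$, $1\le j\le d$), let $[\mathcal L(a)]_{d(k-1)+j}=a\cdot\big((\lambda^{-1}A)^{k-1}Ce_j\big)$, let $\pi$ be the projection on the first $N$ coordinates, and $\theta(a)=K^{-\top}\Lambda\,\pi(\mathcal L(a))$. Let $\mu_{A,B,C}$ be the image of $\mu$ under $$(w,a,c,b)\mapsto\Big(w,\ \theta(a),\ c,\ -\theta(a)\cdot\sum_{k=1}^{T}(A^{E})^{k-1}B^{E}+a\cdot\sum_{k=0}^\infty A^kB+b\Big).$$ Let $\mathcal W_1$ be the 1-Wasserstein distance for the Euclidean distance on $\mathcal X^N$. For a probability measure $\nu_0$ on $\mathcal X^N$ let $\mathcal J_{\nu_0}=\big\|\tfrac{d\mu_{A,B,C}}{d\nu_0}\big\|_{L^\infty(\nu_0)}^{1/2}$, understood as $\infty$ if $\mu_{A,B,C}\not\ll\nu_0$. **Claim.** There is a constant $\tilde c_1>0$ depending only on $d,\sigma_2,p,M,\lambda$ such that in every situation as above, for every probability measure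 $\nu_0$ on $\mathcal X^N$ with finite first moment and every $\delta\in(0,1)$, there are a probability measure $\nu$ on $\mathcal X^N$ with $\mathcal W_1(\nu_0,\nu)\le\delta$ and a measurable $f:(\mathcal X^N)^N\to\mathbb R^N$ such that, when $V_1,\dots,V_N$ are i.i.d. with law $\nu$ and $W=f(V_1,\dots,V_N)$, for every $z\in\mathcal I_d$ (for which the bounded solution $x^{E}(z)$ exists and is unique) $$\mathbb E\big[|H(z)-\widehat H(z)|^2\big]^{1/2}\le \tilde C\Big[\lambda^{N/d}+|||A^{E}|||^{N/d}+N^{-1/2}\min\big(\delta^{-1/2},\mathcal J_{\nu_0}\big)\Big],$$ where $\tilde C=C_{H}\,\max\big(1,\mathcal W_1(\nu_0,\mu_{A,B,C})\big)^{1/2}$ and $$C_{H}=\tilde c_1\max\Big(\tfrac{|||C|||}{(1-|||\lambda^{-1}A|||^p)^{1/p}},\tfrac{\|B\|_q}{1-|||A|||},1\Big)\max\big(I_{\mu,p},I^{(2)}_{\mu,p}\big)\Big(1+\tfrac{|||C^{E}|||+\|B^{E}\|}{1-|||A^{E}|||}\,|||K^{-\top}\Lambda|||\Big).$$ -/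

import Mathlib

open MeasureTheory
open scoped ENNReal NNReal Matrix Matrix.Norms.L2Operator

namespace RecurrentBarron

noncomputable section

/-- `ℝ^n` with the Euclidean norm. -/
abbrev Vec (n : ℕ) : Type := EuclideanSpace ℝ (Fin n)

/-- The real sequence space `ℓ^p`. The coordinate written `x_{i+1}` on paper is `x i`. -/
abbrev EllP (p : ℝ≥0∞) : Type := lp (fun _ : ℕ => ℝ) p

/-- `ℓ^p` carries its Borel σ-algebra. -/
instance instMeasurableSpaceEllP (p : ℝ≥0∞) [Fact (1 ≤ p)] : MeasurableSpace (EllP p) :=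
  borel (EllP p)

instance instBorelSpaceEllP (p : ℝ≥0∞) [Fact (1 ≤ p)] : BorelSpace (EllP p) := ⟨rfl⟩

/-- The pairing `a · x = ∑ i, a_i x_i` of `a ∈ ℓ^p` and `x ∈ ℓ^q`. -/
def pairing {p q : ℝ≥0∞} (a : EllP p) (x : EllP q) : ℝ := ∑' i, a i * x i

/-- `𝒳 = ℝ × ℓ^p × ℝ^d × ℝ`, with points `(w, a, c, b)`. -/
abbrev X (p : ℝ≥0∞) (d : ℕ) : Type := ℝ × EllP p × Vec d × ℝ

/-- `𝒳^N = ℝ × ℝ^N × ℝ^d × ℝ`, with points `(w, a, c, b)`. -/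
abbrev XN (N d : ℕ) : Type := ℝ × Vec N × Vec d × ℝ

/-- Sequences indexed by the non-positive integers: the entry at time `-n` is the value at `n`. -/
abbrev PastSeq (E : Type) : Type := ℕ → E

/-! ### Recurrent Barron functionals -/

/-- The parameters of the state equation `x_t = σ₁(A x_{t-1} + C z_t + B)` on `ℓ^q`,
with bounded linear maps `A` and `C`. -/
structure StateSystem (q : ℝ≥0∞) [Fact (1 ≤ q)] (d : ℕ) where
  A : EllP q →L[ℝ] EllP q
  B : EllP q
  C : Vec d →L[ℝ] EllP q

/-- `x` is a solution in `ℓ^∞_-(ℓ^q)` of `x_t = σ₁(A x_{t-1} + C z_t + B)`, `t ≤ 0`, where `σ₁`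
acts componentwise. -/
def StateSystem.IsSolution {q : ℝ≥0∞} [Fact (1 ≤ q)] {d : ℕ} (S : StateSystem q d) (σ₁ : ℝ → ℝ)
    (z : PastSeq (Vec d)) (x : PastSeq (EllP q)) : Prop :=
  (∃ R : ℝ, ∀ n, ‖x n‖ ≤ R) ∧
    ∀ n i, x n i = σ₁ ((S.A (x (n + 1)) + S.C (z n) + S.B) i)

/-- The functional `H` on the set `I` of inputs is the recurrent generalized Barron functional
given by the state equation `S` and the measure `μ`. -/
def IsRealization {p q : ℝ≥0∞} [Fact (1 ≤ p)] [Fact (1 ≤ q)] {d : ℕ} (σ₁ σ₂ : ℝ → ℝ)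
    (I : Set (PastSeq (Vec d))) (H : PastSeq (Vec d) → ℝ) (S : StateSystem q d)
    (μ : Measure (X p d)) : Prop :=
  (∀ z ∈ I, ∃! x, S.IsSolution σ₁ z x) ∧
  Integrable (fun v : X p d => |v.1| * (‖v.2.1‖ + ‖v.2.2.1‖ + |v.2.2.2|)) μ ∧
  ∀ z ∈ I, ∀ x, S.IsSolution σ₁ z x →
    H z = ∫ v : X p d, v.1 * σ₂ (pairing v.2.1 (x 1) + inner ℝ v.2.2.1 (z 0) + v.2.2.2) ∂μ

/-- `I_{μ,p}`. -/
def firstOrderIntegral {p : ℝ≥0∞} [Fact (1 ≤ p)] {d : ℕ} (μ : Measure (X p d)) : ℝ :=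
  ∫ v : X p d, |v.1| * (‖v.2.1‖ + ‖v.2.2.1‖ + |v.2.2.2|) ∂μ

/-- The integrand `w² (‖a‖² + ‖c‖² + |b|² + 1)`. -/
def secondOrderIntegrand {p : ℝ≥0∞} [Fact (1 ≤ p)] {d : ℕ} (v : X p d) : ℝ :=
  v.1 ^ 2 * (‖v.2.1‖ ^ 2 + ‖v.2.2.1‖ ^ 2 + |v.2.2.2| ^ 2 + 1)

/-- `I_{μ,p}^{(2)}`. -/
def secondOrderIntegral {p : ℝ≥0∞} [Fact (1 ≤ p)] {d : ℕ} (μ : Measure (X p d)) : ℝ :=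
  Real.sqrt (∫ v : X p d, secondOrderIntegrand v ∂μ)

/-! ### Echo state networks with random neural network readout -/

/-- The parameters of the echo state network `x_t = σ₁(A x_{t-1} + C z_t + B)` on `ℝ^N`. -/
structure ESN (N d : ℕ) where
  A : Matrix (Fin N) (Fin N) ℝ
  B : Vec N
  C : Matrix (Fin N) (Fin d) ℝ

/-- `x` is a bounded solution of the echo state network equation for the input `z`. -/
def ESN.IsSolution {N d : ℕ} (E : ESN N d) (σ₁ : ℝ → ℝ)
    (z : PastSeq (Vec d)) (x : PastSeq (Vec N)) : Prop :=
  (∃ R : ℝ, ∀ n, ‖x n‖ ≤ R) ∧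
    ∀ n i, x n i = σ₁ ((E.A *ᵥ (x (n + 1)).ofLp) i + (E.C *ᵥ (z n).ofLp) i + E.B i)

/-- The controllability matrix: the first `N` columns of `(C | A C | A² C | ⋯)`. -/
def ESN.controllability {N d : ℕ} [NeZero d] (E : ESN N d) : Matrix (Fin N) (Fin N) ℝ :=
  Matrix.of fun i j => (E.A ^ (j.val / d) * E.C) i (Fin.ofNat d j.val)

/-- The diagonal matrix with entry `lam^(k-1)` at the positions `d(k-1)+j`, `1 ≤ j ≤ d`. -/
def scaling (N d : ℕ) (lam : ℝ) : Matrix (Fin N) (Fin N) ℝ :=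
  Matrix.diagonal fun i => lam ^ (i.val / d)

/-- The matrix `K^{-⊤} Λ`. -/
def ESN.transfer {N d : ℕ} [NeZero d] (E : ESN N d) (lam : ℝ) : Matrix (Fin N) (Fin N) ℝ :=
  (E.controllability)⁻¹ᵀ * scaling N d lam

/-- `∑_{k=1}^T A^{k-1} B` with `T = ⌈N/d⌉`. -/
def ESN.biasSum {N d : ℕ} (E : ESN N d) : Vec N :=
  WithLp.toLp 2 (∑ k ∈ Finset.range ⌈(N : ℝ) / (d : ℝ)⌉₊, (E.A ^ k) *ᵥ E.B.ofLp)

/-- The output `∑ i, W_i σ₂(a_i · x_{-1} + c_i · z_0 + b_i)` of the network with hidden weights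
`V i = (w_i, a_i, c_i, b_i)`, where `x` and `z` are the state and input sequences. -/
def elmOutput {N d : ℕ} (σ₂ : ℝ → ℝ) (W : Fin N → ℝ) (V : Fin N → XN N d)
    (x : PastSeq (Vec N)) (z : PastSeq (Vec d)) : ℝ :=
  ∑ i, W i * σ₂ (inner ℝ (V i).2.1 (x 1) + inner ℝ (V i).2.2.1 (z 0) + (V i).2.2.2)

/-! ### The measure on the hidden weights induced by a realization -/

/-- The sequence `ℒ(a)` with `ℒ(a)_{d(k-1)+j} = [((lam⁻¹ A)^{k-1} C)^* a]_j`, that is,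
`a · (lam⁻¹ A)^{k-1} C e_j`. -/
def adjointSeq {p q : ℝ≥0∞} [Fact (1 ≤ q)] {d : ℕ} [NeZero d] (lam : ℝ) (S : StateSystem q d)
    (a : EllP p) (i : ℕ) : ℝ :=
  pairing a (((lam⁻¹ • S.A) ^ (i / d)) (S.C (EuclideanSpace.single (Fin.ofNat d i) 1)))

/-- `K^{-⊤} Λ π(ℒ(a)) ∈ ℝ^N`. -/
def transferredWeight {p q : ℝ≥0∞} [Fact (1 ≤ q)] {N d : ℕ} [NeZero d] (lam : ℝ)
    (S : StateSystem q d) (E : ESN N d) (a : EllP p) : Vec N :=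
  WithLp.toLp 2 (E.transfer lam *ᵥ fun i : Fin N => adjointSeq lam S a i.val)

/-- The map `ψ_{A,B,C} : 𝒳 → 𝒳^N`. -/
def weightMap {p q : ℝ≥0∞} [Fact (1 ≤ q)] {N d : ℕ} [NeZero d] (lam : ℝ)
    (S : StateSystem q d) (E : ESN N d) (v : X p d) : XN N d :=
  (v.1, transferredWeight lam S E v.2.1, v.2.2.1,
    -inner ℝ (transferredWeight lam S E v.2.1) E.biasSum
      + pairing v.2.1 (∑' k : ℕ, (S.A ^ k) S.B) + v.2.2.2)

/-- `μ_{A,B,C}`, the image of `μ` under `ψ_{A,B,C}`. -/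
def inducedMeasure {p q : ℝ≥0∞} [Fact (1 ≤ p)] [Fact (1 ≤ q)] {N d : ℕ} [NeZero d] (lam : ℝ)
    (S : StateSystem q d) (E : ESN N d) (μ : Measure (X p d)) : Measure (XN N d) :=
  μ.map (weightMap lam S E)

/-! ### Wasserstein distance, densities, constants -/

/-- The Euclidean norm on `𝒳^N = ℝ × ℝ^N × ℝ^d × ℝ`. -/
def euclNorm {N d : ℕ} (v : XN N d) : ℝ :=
  Real.sqrt (v.1 ^ 2 + ‖v.2.1‖ ^ 2 + ‖v.2.2.1‖ ^ 2 + v.2.2.2 ^ 2)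

/-- The 1-Wasserstein distance for the Euclidean distance on `𝒳^N`: the infimum of the transport
cost over all couplings. -/
def wasserstein1 {N d : ℕ} (ν₁ ν₂ : Measure (XN N d)) : ℝ≥0∞ :=
  ⨅ (γ : Measure (XN N d × XN N d)) (_ : γ.map Prod.fst = ν₁ ∧ γ.map Prod.snd = ν₂),
    ∫⁻ v, ENNReal.ofReal (euclNorm (v.1 - v.2)) ∂γ

open Classical in
/-- `‖dμ/dν‖_∞`, which is `∞` if `μ` is not absolutely continuous with respect to `ν`. -/
def densityBound {N d : ℕ} (μ ν : Measure (XN N d)) : ℝ≥0∞ :=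
  if μ ≪ ν then essSup (μ.rnDeriv ν) ν else ∞

/-- The constant `C_{H,ESN}` with leading factor `c₁`. -/
def approxConst {p q : ℝ≥0∞} [Fact (1 ≤ p)] [Fact (1 ≤ q)] {N d : ℕ} [NeZero d] (c₁ lam : ℝ)
    (S : StateSystem q d) (E : ESN N d) (μ : Measure (X p d)) : ℝ :=
  c₁ * max (max (‖S.C‖ / (1 - ‖lam⁻¹ • S.A‖ ^ p.toReal) ^ (1 / p.toReal))
        (‖S.B‖ / (1 - ‖S.A‖))) 1
    * max (firstOrderIntegral μ) (secondOrderIntegral μ)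
    * (1 + (‖E.C‖ + ‖E.B‖) / (1 - ‖E.A‖) * ‖E.transfer lam‖)

end

end RecurrentBarron

/-! The error splits into a deterministic truncation error and a Monte Carlo error.

Truncation. After `T + 1 = ⌈N/d⌉` steps both states are, up to geometrically small tails and one
incomplete block, a bias term plus a linear combination of the first `N` columns of `(C | AC | ⋯)`,
with the same stacked inputs as coefficients. For the network these columns form `K`, so the weight
`θ(a) = K^{-⊤} Λ π(ℒ(a))` satisfies `θ(a) · K s = ∑ i, s i * (a · column i)`
(`inner_transferredWeight`). Hence `θ(a)` reads off the network state what `a` reads off the system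
state, and the bias correction in `weightMap` aligns the constant terms. This is
`abs_transferred_sub_le`.

Its weak point is `‖θ(a)‖`, which the estimate here bounds only with a factor `√N`. A dichotomy on
the gain `Y = (‖C‖ + ‖B‖) / (1 - ‖A‖) * ‖K^{-⊤} Λ‖` of the network removes that factor. Since `1 ≤
‖K^{-⊤} Λ‖ * ‖C‖`, one has `(1 - ‖A‖)⁻¹ ≤ Y`. If `Y < √N`, then `‖A‖ ≤ 1 - N^{-1/2}`, and about
`N/d` steps of such a contraction make even `√N * ‖A‖ ^ T` of order `N^{-1/2}` (`sqrt_mul_pow_le`).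
If `Y ≥ √N`, the factor `1 + Y` in the constant cancels `N^{-1/2}`, and the zero readout is already
good enough.

Sampling. The integral against the induced measure `μ'` is estimated by importance sampling from
`ν`: the readout is the density `dμ'/dν` times `w`, divided by `N`, and the variance costs the
supremum of the density (`eLpNorm_importance_sampling_le`). For `ν` one takes `ν₀` itself when its
density bound is at most `δ⁻¹`, and otherwise mixes a share `ε = δ / max 1 W₁` of `μ'` into `ν₀`.
This moves `ν₀` by at most `δ` and bounds the density by `ε⁻¹` (`exists_reference`). -/

namespace RecurrentBarron

/-! ### Bounded solutions of affine recursions -/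

section Recursion

variable {F : Type*} [NormedAddCommGroup F] [NormedSpace ℝ F]

lemma norm_pow_apply_le (A : F →L[ℝ] F) (k : ℕ) (x : F) : ‖(A ^ k) x‖ ≤ ‖A‖ ^ k * ‖x‖ := by
  induction k with
  | zero => simp
  | succ k ih =>
    rw [pow_succ', mul_apply_eq_comp, pow_succ', mul_assoc]
    exact (A.le_opNorm _).trans (mul_le_mul_of_nonneg_left ih (norm_nonneg _))

/-- Iterating `m` times leaves only `‖A‖ ^ m * R` of the a priori bound `R`, so any bounded solution
obeys the geometric series bound. The case `U = 0` yields uniqueness. -/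
lemma norm_le_of_recursion {A : F →L[ℝ] F} (hA : ‖A‖ < 1) {x u : ℕ → F}
    (hx : ∃ R : ℝ, ∀ n, ‖x n‖ ≤ R) (h : ∀ n, x n = A (x (n + 1)) + u n) {U : ℝ}
    (hu : ∀ n, ‖u n‖ ≤ U) (n : ℕ) : ‖x n‖ ≤ U / (1 - ‖A‖) := by
  obtain ⟨R, hR⟩ := hx
  have h1 : 0 < 1 - ‖A‖ := by linarith
  have hU : 0 ≤ U := (norm_nonneg _).trans (hu 0)
  have key : ∀ m n, ‖x n‖ ≤ U / (1 - ‖A‖) + ‖A‖ ^ m * R := by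
    intro m
    induction m with
    | zero =>
      intro n
      have := hR n
      have h2 : 0 ≤ U / (1 - ‖A‖) := by positivity
      simp only [pow_zero, one_mul]
      linarith
    | succ m ih =>
      intro n
      calc ‖x n‖ ≤ ‖A (x (n + 1))‖ + ‖u n‖ := by rw [h n]; exact norm_add_le _ _
        _ ≤ ‖A‖ * (U / (1 - ‖A‖) + ‖A‖ ^ m * R) + U :=
          add_le_add ((A.le_opNorm _).trans
            (mul_le_mul_of_nonneg_left (ih _) (norm_nonneg _))) (hu n)
        _ = U / (1 - ‖A‖) + ‖A‖ ^ (m + 1) * R := by field_simp; ring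
  have hlim : Filter.Tendsto (fun m : ℕ => U / (1 - ‖A‖) + ‖A‖ ^ m * R) Filter.atTop
      (nhds (U / (1 - ‖A‖) + 0 * R)) :=
    ((tendsto_pow_atTop_nhds_zero_of_lt_one (norm_nonneg _) hA).mul_const R).const_add _
  have := ge_of_tendsto' hlim fun m => key m n
  simpa using this

/-- Indices count time backwards, so `x (n + 1)` is the predecessor of `x n`; the last term is the
tail that truncation discards. -/
lemma recursion_unroll {A : F →L[ℝ] F} {x u : ℕ → F} (h : ∀ n, x n = A (x (n + 1)) + u n)
    (n m : ℕ) : x n = ∑ k ∈ Finset.range m, (A ^ k) (u (n + k)) + (A ^ m) (x (n + m)) := by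
  induction m with
  | zero => simp
  | succ m ih =>
    rw [Finset.sum_range_succ, pow_succ, mul_apply_eq_comp]
    conv_lhs => rw [ih, h (n + m), map_add]
    rw [add_assoc n m 1]
    abel

lemma summable_pow_apply [CompleteSpace F] {A : F →L[ℝ] F} (hA : ‖A‖ < 1) {u : ℕ → F} {U : ℝ}
    (hu : ∀ n, ‖u n‖ ≤ U) : Summable fun k => (A ^ k) (u k) := by
  refine Summable.of_norm_bounded
    ((summable_geometric_of_lt_one (norm_nonneg A) hA).mul_right U) fun k => ?_
  exact (norm_pow_apply_le A k _).trans
    (mul_le_mul_of_nonneg_left (hu k) (pow_nonneg (norm_nonneg _) _))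

lemma tsum_pow_apply_recursion [CompleteSpace F] {A : F →L[ℝ] F} (hA : ‖A‖ < 1) {u : ℕ → F} {U : ℝ}
    (hu : ∀ n, ‖u n‖ ≤ U) :
    ∑' k, (A ^ k) (u k) = A (∑' k, (A ^ k) (u (k + 1))) + u 0 := by
  have hs := summable_pow_apply hA hu
  have hs' : Summable fun k => (A ^ k) (u (k + 1)) := summable_pow_apply hA fun n => hu (n + 1)
  rw [hs.tsum_eq_zero_add, A.map_tsum hs', add_comm]
  simp [pow_succ']

lemma norm_tsum_pow_apply_le [CompleteSpace F] {A : F →L[ℝ] F} (hA : ‖A‖ < 1) {u : ℕ → F} {U : ℝ}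
    (hu : ∀ n, ‖u n‖ ≤ U) : ‖∑' k, (A ^ k) (u k)‖ ≤ U / (1 - ‖A‖) := by
  rw [div_eq_inv_mul, ← tsum_geometric_of_lt_one (norm_nonneg A) hA, ← tsum_mul_right]
  refine tsum_of_norm_bounded
    ((summable_geometric_of_lt_one (norm_nonneg A) hA).mul_right U).hasSum fun k => ?_
  exact (norm_pow_apply_le A k _).trans
    (mul_le_mul_of_nonneg_left (hu k) (pow_nonneg (norm_nonneg _) _))

/-- The solution is the convolution series over the past. The difference of two bounded solutions
solves the recursion without input, hence vanishes. -/
lemma existsUnique_bounded_recursion [CompleteSpace F] {A : F →L[ℝ] F} (hA : ‖A‖ < 1)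
    {u : ℕ → F} {U : ℝ} (hu : ∀ n, ‖u n‖ ≤ U) :
    ∃! x : ℕ → F, (∃ R : ℝ, ∀ n, ‖x n‖ ≤ R) ∧ ∀ n, x n = A (x (n + 1)) + u n := by
  refine ⟨fun n => ∑' k, (A ^ k) (u (n + k)),
    ⟨⟨U / (1 - ‖A‖), fun n => norm_tsum_pow_apply_le hA fun k => hu (n + k)⟩, fun n => ?_⟩, ?_⟩
  · have := tsum_pow_apply_recursion hA (u := fun k => u (n + k)) fun k => hu (n + k)
    simpa [add_assoc, add_comm, add_left_comm] using this
  · rintro y ⟨hyb, hy⟩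
    obtain ⟨R, hR⟩ := hyb
    have hz := norm_le_of_recursion hA
      (x := fun n => y n - ∑' k, (A ^ k) (u (n + k))) (u := fun _ => 0) (U := 0)
      ⟨R + U / (1 - ‖A‖), fun n => (norm_sub_le _ _).trans
        (add_le_add (hR n) (norm_tsum_pow_apply_le hA fun k => hu (n + k)))⟩
      (fun n => by
        have := tsum_pow_apply_recursion hA (u := fun k => u (n + k)) fun k => hu (n + k)
        have h2 : ∑' k, (A ^ k) (u (n + k)) = A (∑' k, (A ^ k) (u (n + 1 + k))) + u n := by
          simpa [add_assoc, add_comm, add_left_comm] using this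
        rw [h2, hy n, map_sub]
        abel)
      (fun n => by simp)
    funext n
    have := hz n
    simp only [zero_div, norm_le_zero_iff] at this
    exact sub_eq_zero.mp this

end Recursion

/-! ### The pairing of `ℓ^p` and `ℓ^q` -/

section Pairing

variable {p q : ℝ≥0∞} [Fact (1 ≤ p)] [Fact (1 ≤ q)] [ENNReal.HolderConjugate p q]

variable (p q) in
/-- The pairing as a continuous bilinear map. -/
noncomputable def pairingCLM : EllP p →L[ℝ] EllP q →L[ℝ] ℝ :=
  lp.dualPairing p q (fun _ : ℕ => ContinuousLinearMap.mul ℝ ℝ) (K := 1)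
    (fun _ => by simp)

lemma pairing_eq (a : EllP p) (x : EllP q) : pairing a x = pairingCLM p q a x := rfl

lemma abs_pairing_le (a : EllP p) (x : EllP q) : |pairing a x| ≤ ‖a‖ * ‖x‖ := by
  have h : ‖pairingCLM p q‖ ≤ 1 := by
    have := lp.norm_dualPairing (p := p) (q := q) (fun _ : ℕ => ContinuousLinearMap.mul ℝ ℝ)
      (K := 1) (fun _ => by simp)
    exact this
  calc |pairing a x| = ‖pairingCLM p q a x‖ := rfl
    _ ≤ ‖pairingCLM p q‖ * ‖a‖ * ‖x‖ := (pairingCLM p q).le_opNorm₂ a x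
    _ ≤ 1 * ‖a‖ * ‖x‖ := by gcongr
    _ = ‖a‖ * ‖x‖ := by ring

lemma measurable_pairing_left (x : EllP q) : Measurable fun a : EllP p => pairing a x :=
  ((ContinuousLinearMap.apply ℝ ℝ x).comp (pairingCLM p q)).continuous.measurable

end Pairing

/-! ### Comparison of the state space with its finite-dimensional surrogate -/

section Columns

variable {F : Type*} [NormedAddCommGroup F] [NormedSpace ℝ F] {d : ℕ} [NeZero d]

/-- The `i`-th column of `(C | A C | A² C | ⋯)`. -/
noncomputable def reachColumn (A : F →L[ℝ] F) (C : Vec d →L[ℝ] F) (i : ℕ) : F :=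
  (A ^ (i / d)) (C (EuclideanSpace.single (Fin.ofNat d i) 1))

/-- The `i`-th coordinate of the stacked input `(z_{-1}, z_{-2}, ⋯)`. -/
def stackedInput (z : PastSeq (Vec d)) (i : ℕ) : ℝ := z (1 + i / d) (Fin.ofNat d i)

/-- Each input is expanded in the standard basis, and `i = T * d + j` encodes block `T` and
coordinate `j`. The inputs start at index `1` because the readout uses the state at time `-1`. -/
lemma sum_pow_apply_eq_sum_reachColumn (A : F →L[ℝ] F) (C : Vec d →L[ℝ] F) (z : PastSeq (Vec d))
    (T : ℕ) : ∑ k ∈ Finset.range T, (A ^ k) (C (z (1 + k))) =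
      ∑ i ∈ Finset.range (T * d), stackedInput z i • reachColumn A C i := by
  have hd : 0 < d := Nat.pos_of_ne_zero (NeZero.ne d)
  induction T with
  | zero => simp
  | succ T ih =>
    rw [Finset.sum_range_succ, ih, Nat.succ_mul, Finset.sum_range_add]
    congr 1
    have hz : z (1 + T) = ∑ j : Fin d, z (1 + T) j • EuclideanSpace.single j (1 : ℝ) := by
      ext i
      simp [Finset.sum_apply, Pi.single_apply]
    rw [hz, map_sum, map_sum, Finset.sum_range]
    refine Finset.sum_congr rfl fun j _ => ?_
    have h1 : (T * d + (j : ℕ)) / d = T := by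
      rw [mul_comm, Nat.mul_add_div hd, Nat.div_eq_of_lt j.2, add_zero]
    have h2 : Fin.ofNat d (T * d + (j : ℕ)) = j := by
      ext
      simp [Fin.ofNat, Nat.mod_eq_of_lt j.2]
    simp only [stackedInput, reachColumn, h1, h2, map_smul]

lemma abs_stackedInput_le {z : PastSeq (Vec d)} {M : ℝ} (hz : ∀ n, ‖z n‖ ≤ M) (i : ℕ) :
    |stackedInput z i| ≤ M :=
  (PiLp.norm_apply_le (z (1 + i / d)) (Fin.ofNat d i)).trans (hz _)

lemma norm_reachColumn_le (A : F →L[ℝ] F) (C : Vec d →L[ℝ] F) (i : ℕ) :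
    ‖reachColumn A C i‖ ≤ ‖A‖ ^ (i / d) * ‖C‖ := by
  refine (norm_pow_apply_le A _ _).trans (mul_le_mul_of_nonneg_left ?_ (by positivity))
  simpa using C.le_opNorm (EuclideanSpace.single (Fin.ofNat d i) (1 : ℝ))

/-- The first `T` input blocks agree with the first `N` columns up to an incomplete block. -/
lemma norm_sum_sub_sum_reachColumn_le (A : F →L[ℝ] F) (C : Vec d →L[ℝ] F) {z : PastSeq (Vec d)}
    {M : ℝ} (hz : ∀ n, ‖z n‖ ≤ M) {N T : ℕ} (h₁ : N ≤ (T + 1) * d) (h₂ : T * d ≤ N) :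
    ‖∑ k ∈ Finset.range (T + 1), (A ^ k) (C (z (1 + k))) -
        ∑ i : Fin N, stackedInput z i • reachColumn A C i‖ ≤ d * (M * (‖A‖ ^ T * ‖C‖)) := by
  have hd : 0 < d := Nat.pos_of_ne_zero (NeZero.ne d)
  have hM : 0 ≤ M := (norm_nonneg _).trans (hz 0)
  rw [sum_pow_apply_eq_sum_reachColumn, ← Finset.sum_range (n := N)
    (f := fun i => stackedInput z i • reachColumn A C i), ← Finset.sum_Ico_eq_sub _ h₁]
  refine (norm_sum_le_of_le _ (f := fun i => stackedInput z i • reachColumn A C i)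
    (n := fun _ => M * (‖A‖ ^ T * ‖C‖)) fun i hi => ?_).trans ?_
  · obtain ⟨hi1, hi2⟩ := Finset.mem_Ico.mp hi
    have hiT : i / d = T := by
      refine le_antisymm (Nat.lt_succ_iff.mp (Nat.div_lt_of_lt_mul (by rwa [mul_comm]))) ?_
      exact (Nat.le_div_iff_mul_le hd).mpr (h₂.trans hi1)
    rw [norm_smul]
    have h3 := norm_reachColumn_le A C i
    rw [hiT] at h3
    exact mul_le_mul (abs_stackedInput_le hz i) h3 (norm_nonneg _) hM
  · rw [Finset.sum_const, Nat.card_Ico, nsmul_eq_mul]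
    refine mul_le_mul_of_nonneg_right ?_ (by positivity)
    have : (T + 1) * d - N ≤ d := by
      rw [Nat.succ_mul]
      omega
    exact_mod_cast this

end Columns

/-! ### The network as a linear system, and the transferred weight. -/

section Network

variable {N d : ℕ}

lemma StateSystem.IsSolution.recursion {q : ℝ≥0∞} [Fact (1 ≤ q)] {S : StateSystem q d}
    {z : PastSeq (Vec d)} {x : PastSeq (EllP q)} (h : S.IsSolution id z x) (n : ℕ) :
    x n = S.A (x (n + 1)) + (S.C (z n) + S.B) := by
  ext i
  have := h.2 n i
  simpa [add_assoc] using this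

/-- The reservoir matrix as a continuous linear map. -/
noncomputable def ESN.stateMap (E : ESN N d) : Vec N →L[ℝ] Vec N :=
  Matrix.toEuclideanCLM (n := Fin N) (𝕜 := ℝ) E.A

/-- The input matrix as a continuous linear map. -/
noncomputable def ESN.inputMap (E : ESN N d) : Vec d →L[ℝ] Vec N :=
  LinearMap.toContinuousLinearMap (Matrix.toEuclideanLin E.C)

lemma ESN.norm_stateMap (E : ESN N d) : ‖E.stateMap‖ = ‖E.A‖ := rfl

lemma ESN.norm_inputMap (E : ESN N d) : ‖E.inputMap‖ = ‖E.C‖ := rfl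

lemma ESN.inputMap_apply (E : ESN N d) (v : Vec d) :
    E.inputMap v = WithLp.toLp 2 (E.C *ᵥ v.ofLp) := rfl

lemma ESN.stateMap_pow_apply (E : ESN N d) (k : ℕ) (v : Vec N) :
    (E.stateMap ^ k) v = WithLp.toLp 2 ((E.A ^ k) *ᵥ v.ofLp) := by
  unfold ESN.stateMap
  rw [← map_pow]
  rfl

lemma ESN.isSolution_iff (E : ESN N d) (z : PastSeq (Vec d)) (x : PastSeq (Vec N)) :
    E.IsSolution id z x ↔ (∃ R : ℝ, ∀ n, ‖x n‖ ≤ R) ∧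
      ∀ n, x n = E.stateMap (x (n + 1)) + (E.inputMap (z n) + E.B) := by
  refine and_congr_right fun _ => forall_congr' fun n => ?_
  constructor
  · intro h
    ext i
    exact (h i).trans (add_assoc _ _ _)
  · intro h i
    rw [h]
    simp only [id, add_assoc]
    rfl

lemma norm_input_add_bias_le {F : Type*} [NormedAddCommGroup F] [NormedSpace ℝ F]
    (C : Vec d →L[ℝ] F) (B : F) {z : PastSeq (Vec d)} {M : ℝ} (hz : ∀ n, ‖z n‖ ≤ M) (n : ℕ) :
    ‖C (z n) + B‖ ≤ ‖C‖ * M + ‖B‖ :=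
  (norm_add_le _ _).trans (add_le_add_left
    ((C.le_opNorm _).trans (mul_le_mul_of_nonneg_left (hz n) (norm_nonneg _))) _)

lemma ESN.existsUnique_isSolution {E : ESN N d} (hE : ‖E.A‖ < 1) {z : PastSeq (Vec d)} {M : ℝ}
    (hz : ∀ n, ‖z n‖ ≤ M) : ∃! x, E.IsSolution id z x := by
  simp only [E.isSolution_iff]
  exact existsUnique_bounded_recursion (A := E.stateMap) hE
    (norm_input_add_bias_le E.inputMap E.B hz)

variable [NeZero d]

lemma ESN.sum_reachColumn (E : ESN N d) (s : Fin N → ℝ) :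
    ∑ i : Fin N, s i • reachColumn E.stateMap E.inputMap i =
      WithLp.toLp 2 (E.controllability *ᵥ s) := by
  ext j
  rw [WithLp.ofLp_sum, Finset.sum_apply]
  simp only [Matrix.mulVec, dotProduct, WithLp.ofLp_smul, Pi.smul_apply, smul_eq_mul]
  refine Finset.sum_congr rfl fun i _ => ?_
  rw [mul_comm]
  congr 1
  simp only [reachColumn, E.stateMap_pow_apply, E.inputMap_apply, ESN.controllability,
    Matrix.of_apply, Matrix.mulVec_mulVec]
  simp

variable {p q : ℝ≥0∞} [Fact (1 ≤ p)] [Fact (1 ≤ q)]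

/-- The coordinates `a · A^{k-1} C e_j` of the functional `a` on the reachable directions. -/
noncomputable def reachCoord (S : StateSystem q d) (a : EllP p) (i : ℕ) : ℝ :=
  pairing a (reachColumn S.A S.C i)

/-- The powers of `lam` in `Λ` cancel those in `ℒ(a)`: `lam` is only a normalisation that moves
decay from `ℒ(a)` into `Λ`. -/
lemma scaling_mulVec_adjointSeq [ENNReal.HolderConjugate p q] {lam : ℝ} (hlam : lam ≠ 0)
    (S : StateSystem q d) (a : EllP p) :
    (scaling N d lam *ᵥ fun i : Fin N => adjointSeq lam S a i) =
      fun i : Fin N => reachCoord S a i := by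
  funext i
  rw [scaling, Matrix.mulVec_diagonal]
  simp only [adjointSeq, reachCoord, reachColumn, pairing_eq, smul_pow,
    smul_apply, map_smul, smul_eq_mul]
  rw [← mul_assoc, ← mul_pow, mul_inv_cancel₀ hlam, one_pow, one_mul]

/-- This identity dictates the form of `θ(a)`: moving `K^{-⊤}` across the inner product cancels `K`.
-/
lemma inner_transferredWeight [ENNReal.HolderConjugate p q] {lam : ℝ} (hlam : lam ≠ 0)
    (S : StateSystem q d) {E : ESN N d} (hK : IsUnit E.controllability) (a : EllP p)
    (s : Fin N → ℝ) :
    inner ℝ (transferredWeight lam S E a) (WithLp.toLp 2 (E.controllability *ᵥ s)) =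
      ∑ i : Fin N, s i * reachCoord S a i := by
  have h : transferredWeight lam S E a =
      WithLp.toLp 2 ((E.controllability)⁻¹ᵀ *ᵥ fun i : Fin N => reachCoord S a i) := by
    rw [transferredWeight, ESN.transfer, ← Matrix.mulVec_mulVec, scaling_mulVec_adjointSeq hlam]
  rw [h, EuclideanSpace.inner_toLp_toLp, star_trivial, Matrix.mulVec_transpose,
    dotProduct_comm, ← Matrix.dotProduct_mulVec, Matrix.mulVec_mulVec,
    Matrix.nonsing_inv_mul _ ((Matrix.isUnit_iff_isUnit_det _).mp hK), Matrix.one_mulVec,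
    dotProduct_comm]
  rfl

lemma abs_adjointSeq_le [ENNReal.HolderConjugate p q] {lam : ℝ} (hlam : 0 < lam)
    {S : StateSystem q d} (hS : ‖S.A‖ < lam) (a : EllP p) (i : ℕ) :
    |adjointSeq lam S a i| ≤ ‖a‖ * ‖S.C‖ := by
  refine (abs_pairing_le a _).trans (mul_le_mul_of_nonneg_left ?_ (norm_nonneg _))
  refine (norm_reachColumn_le (lam⁻¹ • S.A) S.C i).trans
    (mul_le_of_le_one_left (norm_nonneg _) (pow_le_one₀ (norm_nonneg _) ?_))
  rw [norm_smul, Real.norm_of_nonneg (by positivity), inv_mul_le_iff₀ hlam, mul_one]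
  exact hS.le

/-- The `N` entries of `ℒ(a)` are bounded one by one, which costs `√N` in the Euclidean norm. -/
lemma norm_transferredWeight_le [ENNReal.HolderConjugate p q] {lam : ℝ} (hlam : 0 < lam)
    {S : StateSystem q d} (hS : ‖S.A‖ < lam) (E : ESN N d) (a : EllP p) :
    ‖transferredWeight lam S E a‖ ≤ ‖E.transfer lam‖ * (√N * (‖a‖ * ‖S.C‖)) := by
  refine (Matrix.l2_opNorm_mulVec (E.transfer lam)
    (WithLp.toLp 2 fun i : Fin N => adjointSeq lam S a i)).trans
    (mul_le_mul_of_nonneg_left ?_ (norm_nonneg _))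
  rw [EuclideanSpace.norm_eq]
  refine Real.sqrt_le_iff.mpr ⟨by positivity, ?_⟩
  rw [mul_pow, Real.sq_sqrt (Nat.cast_nonneg _)]
  refine (Finset.sum_le_sum (g := fun _ => (‖a‖ * ‖S.C‖) ^ 2) fun i _ => ?_).trans
    (le_of_eq (by simp))
  exact pow_le_pow_left₀ (norm_nonneg _) (abs_adjointSeq_le hlam hS a i) 2

/-- The state of the network, weighted by the transferred weight, reproduces the weighted state of
the system up to the truncation error. -/
lemma abs_transferred_sub_le [ENNReal.HolderConjugate p q] {lam : ℝ} (hlam : lam ∈ Set.Ioo 0 1)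
    {S : StateSystem q d} (hS : ‖S.A‖ < lam) {E : ESN N d} (hE : ‖E.A‖ < 1)
    (hK : IsUnit E.controllability) {z : PastSeq (Vec d)} {M : ℝ} (hz : ∀ n, ‖z n‖ ≤ M)
    {x : PastSeq (EllP q)} (hx : S.IsSolution id z x) {y : PastSeq (Vec N)}
    (hy : E.IsSolution id z y) {T : ℕ} (hT : ⌈(N : ℝ) / (d : ℝ)⌉₊ = T + 1) (a : EllP p) :
    |inner ℝ (transferredWeight lam S E a) (y 1)
        + (-inner ℝ (transferredWeight lam S E a) E.biasSum
          + pairing a (∑' k : ℕ, (S.A ^ k) S.B)) - pairing a (x 1)| ≤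
      ‖transferredWeight lam S E a‖ * (d * (M * (‖E.A‖ ^ T * ‖E.C‖))
        + ‖E.A‖ ^ (T + 1) * ((‖E.C‖ * M + ‖E.B‖) / (1 - ‖E.A‖)))
      + ‖a‖ * (d * (M * (‖S.A‖ ^ T * ‖S.C‖))
        + ‖S.A‖ ^ (T + 1) * (‖S.B‖ / (1 - ‖S.A‖))
        + ‖S.A‖ ^ (T + 1) * ((‖S.C‖ * M + ‖S.B‖) / (1 - ‖S.A‖))) := by
  have hd : (0 : ℝ) < d := by exact_mod_cast Nat.pos_of_ne_zero (NeZero.ne d)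
  have hS1 : ‖S.A‖ < 1 := hS.trans hlam.2
  -- The `N` columns fill `T` blocks of length `d` and part or all of block `T + 1`.
  have h₁ : N ≤ (T + 1) * d := by
    have := Nat.le_ceil ((N : ℝ) / d)
    rw [hT, div_le_iff₀ hd] at this
    exact_mod_cast this
  have h₂ : T * d ≤ N := by
    have : (T : ℝ) < N / d := Nat.lt_ceil.mp (by omega)
    rw [lt_div_iff₀ hd] at this
    exact_mod_cast this.le
  obtain ⟨hyb, hyr⟩ := (E.isSolution_iff z y).mp hy
  set θ := transferredWeight lam S E a
  set e₁ := ∑ k ∈ Finset.range (T + 1), (E.stateMap ^ k) (E.inputMap (z (1 + k))) -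
    ∑ i : Fin N, stackedInput z i • reachColumn E.stateMap E.inputMap i with he₁
  set e₂ := ∑ k ∈ Finset.range (T + 1), (S.A ^ k) (S.C (z (1 + k))) -
    ∑ i : Fin N, stackedInput z i • reachColumn S.A S.C i with he₂
  have hne₁ := norm_sum_sub_sum_reachColumn_le E.stateMap E.inputMap hz h₁ h₂
  have hne₂ := norm_sum_sub_sum_reachColumn_le S.A S.C hz h₁ h₂
  rw [← he₁, E.norm_stateMap, E.norm_inputMap] at hne₁
  rw [← he₂] at hne₂
  have hbias : E.biasSum = ∑ k ∈ Finset.range (T + 1), (E.stateMap ^ k) E.B := by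
    rw [ESN.biasSum, hT, WithLp.toLp_sum]
    exact Finset.sum_congr rfl fun k _ => (E.stateMap_pow_apply k E.B).symm
  have hyu : y 1 = (WithLp.toLp 2 (E.controllability *ᵥ fun i : Fin N => stackedInput z i) + e₁)
      + E.biasSum + (E.stateMap ^ (T + 1)) (y (1 + (T + 1))) := by
    rw [recursion_unroll hyr 1 (T + 1), hbias, ← E.sum_reachColumn, he₁]
    simp only [map_add, Finset.sum_add_distrib]
    abel
  set b := ∑' k : ℕ, (S.A ^ k) S.B
  -- The total bias `b` is the stationary solution of the recursion; unrolling it expresses the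
  -- partial bias sum as `b` minus a tail.
  have hbr : b = S.A b + S.B := tsum_pow_apply_recursion hS1 (u := fun _ => S.B) fun _ => le_rfl
  have hbn : ‖b‖ ≤ ‖S.B‖ / (1 - ‖S.A‖) :=
    norm_tsum_pow_apply_le hS1 (u := fun _ => S.B) fun _ => le_rfl
  have hbu : b = ∑ k ∈ Finset.range (T + 1), (S.A ^ k) S.B + (S.A ^ (T + 1)) b :=
    recursion_unroll (x := fun _ => b) (u := fun _ => S.B) (fun _ => hbr) 0 (T + 1)
  have hxu : x 1 = (∑ i : Fin N, stackedInput z i • reachColumn S.A S.C i + e₂)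
      + (b - (S.A ^ (T + 1)) b) + (S.A ^ (T + 1)) (x (1 + (T + 1))) := by
    rw [recursion_unroll hx.recursion 1 (T + 1), he₂]
    conv_rhs => enter [1, 2, 1]; rw [hbu]
    simp only [map_add, Finset.sum_add_distrib]
    abel
  have hyn := norm_le_of_recursion (A := E.stateMap) hE hyb hyr
    (norm_input_add_bias_le E.inputMap E.B hz) (1 + (T + 1))
  have hxn := norm_le_of_recursion hS1 hx.1 hx.recursion
    (norm_input_add_bias_le S.C S.B hz) (1 + (T + 1))
  rw [E.norm_stateMap, E.norm_inputMap] at hyn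
  have hP : pairing a (∑ i : Fin N, stackedInput z i • reachColumn S.A S.C i) =
      ∑ i : Fin N, stackedInput z i * reachCoord S a i := by
    simp only [pairing_eq, reachCoord, map_sum, map_smul, smul_eq_mul]
  have hpx : pairing a (x 1) = ∑ i : Fin N, stackedInput z i * reachCoord S a i + pairing a e₂
      + (pairing a b - pairing a ((S.A ^ (T + 1)) b))
      + pairing a ((S.A ^ (T + 1)) (x (1 + (T + 1)))) := by
    conv_lhs => rw [hxu]
    rw [← hP]
    simp only [pairing_eq, map_add, map_sub]
  have hiy : inner ℝ θ (y 1) = ∑ i : Fin N, stackedInput z i * reachCoord S a i + inner ℝ θ e₁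
      + inner ℝ θ E.biasSum + inner ℝ θ ((E.stateMap ^ (T + 1)) (y (1 + (T + 1)))) := by
    conv_lhs => rw [hyu]
    rw [inner_add_right, inner_add_right, inner_add_right,
      inner_transferredWeight hlam.1.ne' S hK a]
  have b1 : |inner ℝ θ e₁| ≤ ‖θ‖ * (d * (M * (‖E.A‖ ^ T * ‖E.C‖))) :=
    (abs_real_inner_le_norm _ _).trans (mul_le_mul_of_nonneg_left hne₁ (norm_nonneg _))
  have b2 : |inner ℝ θ ((E.stateMap ^ (T + 1)) (y (1 + (T + 1))))| ≤
      ‖θ‖ * (‖E.A‖ ^ (T + 1) * ((‖E.C‖ * M + ‖E.B‖) / (1 - ‖E.A‖))) :=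
    (abs_real_inner_le_norm _ _).trans (mul_le_mul_of_nonneg_left
      ((norm_pow_apply_le _ _ _).trans (mul_le_mul_of_nonneg_left hyn (by positivity)))
      (norm_nonneg _))
  have b3 : |pairing a e₂| ≤ ‖a‖ * (d * (M * (‖S.A‖ ^ T * ‖S.C‖))) :=
    (abs_pairing_le _ _).trans (mul_le_mul_of_nonneg_left hne₂ (norm_nonneg _))
  have b4 : |pairing a ((S.A ^ (T + 1)) b)| ≤
      ‖a‖ * (‖S.A‖ ^ (T + 1) * (‖S.B‖ / (1 - ‖S.A‖))) :=
    (abs_pairing_le _ _).trans (mul_le_mul_of_nonneg_left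
      ((norm_pow_apply_le _ _ _).trans (mul_le_mul_of_nonneg_left hbn (by positivity)))
      (norm_nonneg _))
  have b5 : |pairing a ((S.A ^ (T + 1)) (x (1 + (T + 1))))| ≤
      ‖a‖ * (‖S.A‖ ^ (T + 1) * ((‖S.C‖ * M + ‖S.B‖) / (1 - ‖S.A‖))) :=
    (abs_pairing_le _ _).trans (mul_le_mul_of_nonneg_left
      ((norm_pow_apply_le _ _ _).trans (mul_le_mul_of_nonneg_left hxn (by positivity)))
      (norm_nonneg _))
  rw [hiy, hpx]
  rw [abs_le] at b1 b2 b3 b4 b5 ⊢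
  constructor <;> linarith [b1.1, b1.2, b2.1, b2.2, b3.1, b3.2, b4.1, b4.2, b5.1, b5.2]

/-- The first diagonal entry of `Λ K⁻¹ (C | ⋯)` is `1`. -/
lemma one_le_norm_transfer_mul_norm (hN : 0 < N) {E : ESN N d} (hK : IsUnit E.controllability)
    (lam : ℝ) : 1 ≤ ‖E.transfer lam‖ * ‖E.C‖ := by
  set i₀ : Fin N := ⟨0, hN⟩
  have hcol : E.inputMap (EuclideanSpace.single (0 : Fin d) 1) =
      WithLp.toLp 2 (E.controllability *ᵥ Pi.single i₀ 1) := by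
    ext j
    simp [E.inputMap_apply, ESN.controllability, i₀]
  -- `Λ` fixes the first basis vector because its first entry is `lam ^ 0`.
  have hrow : E.transfer lam *ᵥ Pi.single i₀ 1 = (E.controllability)⁻¹ᵀ *ᵥ Pi.single i₀ 1 := by
    rw [ESN.transfer, ← Matrix.mulVec_mulVec]
    congr 1
    funext j
    rw [scaling, Matrix.mulVec_diagonal]
    by_cases h : j = i₀
    · subst h
      simp [i₀]
    · simp [h]
  have hone : inner ℝ (WithLp.toLp 2 (E.transfer lam *ᵥ Pi.single i₀ 1) : Vec N)
      (E.inputMap (EuclideanSpace.single (0 : Fin d) 1)) = 1 := by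
    rw [hcol, hrow, EuclideanSpace.inner_toLp_toLp, star_trivial, Matrix.mulVec_transpose,
      dotProduct_comm, ← Matrix.dotProduct_mulVec, Matrix.mulVec_mulVec,
      Matrix.nonsing_inv_mul _ ((Matrix.isUnit_iff_isUnit_det _).mp hK), Matrix.one_mulVec]
    simp
  have h1 : ‖(WithLp.toLp 2 (E.transfer lam *ᵥ Pi.single i₀ 1) : Vec N)‖ ≤ ‖E.transfer lam‖ := by
    simpa using Matrix.l2_opNorm_mulVec (E.transfer lam) (EuclideanSpace.single i₀ (1 : ℝ))
  have h2 : ‖E.inputMap (EuclideanSpace.single (0 : Fin d) 1)‖ ≤ ‖E.C‖ := by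
    simpa [E.norm_inputMap] using E.inputMap.le_opNorm (EuclideanSpace.single (0 : Fin d) (1 : ℝ))
  rw [← hone]
  exact (real_inner_le_norm _ _).trans (mul_le_mul h1 h2 (norm_nonneg _) (norm_nonneg _))

end Network

/-! ### Importance sampling -/

section Sampling

open ProbabilityTheory

variable {Ω : Type*} [MeasurableSpace Ω]

lemma eLpNorm_two_sq {μ : Measure Ω} (f : Ω → ℝ) :
    eLpNorm f 2 μ ^ 2 = ∫⁻ x, ‖f x‖ₑ ^ 2 ∂μ := by
  have := eLpNorm_nnreal_pow_eq_lintegral (μ := μ) (f := f) (p := 2) (by norm_num)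
  simpa using this

lemma le_mul_of_sq_le_sq_mul {a r b : ℝ≥0∞} (h : a ^ 2 ≤ r * b ^ 2) :
    a ≤ r ^ (1 / 2 : ℝ) * b := by
  have hsq : ∀ t : ℝ≥0∞, (t ^ 2) ^ (1 / 2 : ℝ) = t := fun t => by
    rw [← ENNReal.rpow_natCast, ← ENNReal.rpow_mul]
    norm_num
  have h' := ENNReal.rpow_le_rpow h (by norm_num : (0 : ℝ) ≤ 1 / 2)
  rwa [ENNReal.mul_rpow_of_nonneg _ _ (by norm_num), hsq, hsq] at h'

/-- The mean of `n` independent copies of `F` has standard deviation at most `n^{-1/2}` times the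
`L²` norm of `F`. -/
lemma eLpNorm_mean_sub_le {n : ℕ} (hn : 0 < n) {ν : Measure Ω} [IsProbabilityMeasure ν]
    {F : Ω → ℝ} (hF : MemLp F 2 ν) :
    eLpNorm (fun V : Fin n → Ω => ∫ v, F v ∂ν - ∑ i, (n : ℝ)⁻¹ * F (V i)) 2
        (Measure.pi fun _ => ν) ≤
      ENNReal.ofReal ((n : ℝ) ^ (-(1 / 2) : ℝ)) * eLpNorm F 2 ν := by
  set P : Measure (Fin n → Ω) := Measure.pi fun _ => ν
  have hn' : (0 : ℝ) < n := by exact_mod_cast hn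
  set G : Fin n → Ω → ℝ := fun _ v => (n : ℝ)⁻¹ * F v
  have hG : ∀ i, MemLp (G i) 2 ν := fun i => hF.const_mul _
  have hGi : ∀ i, MemLp (fun V : Fin n → Ω => G i (V i)) 2 P := fun i =>
    (hG i).comp_measurePreserving (measurePreserving_eval _ i)
  set Y : (Fin n → Ω) → ℝ := ∑ i, fun V => G i (V i)
  have hY : MemLp Y 2 P := memLp_finsetSum' _ fun i _ => hGi i
  have hmean : P[Y] = ∫ v, F v ∂ν := by
    have h1 : ∀ i : Fin n, ∫ V, G i (V i) ∂P = (n : ℝ)⁻¹ * ∫ v, F v ∂ν := fun i => by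
      have := integral_comp_eval (μ := fun _ : Fin n => ν) (i := i) (f := G i)
        (hG i).aestronglyMeasurable
      rw [this, integral_const_mul]
    have h2 : P[Y] = ∑ i, ∫ V, G i (V i) ∂P := by
      simp only [Y, Finset.sum_apply]
      exact integral_finsetSum _ fun i _ => (hGi i).integrable (by norm_num)
    rw [h2, Finset.sum_congr rfl fun i _ => h1 i]
    simp [hn'.ne']
  have hvar : eVar[Y; P] ≤ ENNReal.ofReal (n : ℝ)⁻¹ * eLpNorm F 2 ν ^ 2 := by
    have h1 : Var[Y; P] ≤ (n : ℝ)⁻¹ * ∫ v, F v ^ 2 ∂ν := by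
      rw [show Var[Y; P] = ∑ i, Var[G i; ν] from variance_sum_pi hG]
      have h2 : ∀ i, Var[G i; ν] ≤ (n : ℝ)⁻¹ ^ 2 * ∫ v, F v ^ 2 ∂ν := fun i => by
        rw [variance_const_mul]
        exact mul_le_mul_of_nonneg_left (variance_le_expectation_sq hF.aestronglyMeasurable)
          (by positivity)
      refine (Finset.sum_le_sum fun i _ => h2 i).trans (le_of_eq ?_)
      simp only [Finset.sum_const, Finset.card_univ, Fintype.card_fin, nsmul_eq_mul]
      field_simp
    rw [← ofReal_variance hY]
    refine (ENNReal.ofReal_le_ofReal h1).trans (le_of_eq ?_)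
    rw [ENNReal.ofReal_mul (by positivity), eLpNorm_two_sq,
      ofReal_integral_eq_lintegral_ofReal hF.integrable_sq (ae_of_all _ fun v => sq_nonneg _)]
    congr 2
    funext v
    rw [← sq_abs, ENNReal.ofReal_pow (abs_nonneg _), Real.enorm_eq_ofReal_abs]
  -- The estimator is unbiased, so its mean square error is its variance.
  have hsq : eLpNorm (fun V : Fin n → Ω => ∫ v, F v ∂ν - ∑ i, (n : ℝ)⁻¹ * F (V i)) 2 P ^ 2
      = eVar[Y; P] := by
    rw [eLpNorm_two_sq, evariance, hmean]
    refine lintegral_congr fun V => ?_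
    rw [← enorm_neg]
    simp [Y, G]
  have := le_mul_of_sq_le_sq_mul (hsq.trans_le hvar)
  rwa [ENNReal.ofReal_rpow_of_pos (by positivity), Real.inv_rpow hn'.le,
    ← Real.rpow_neg hn'.le] at this

variable {μ ν : Measure Ω} [IsProbabilityMeasure μ] [IsProbabilityMeasure ν]

/-- Of the two density factors in the square, one is bounded by `R` and the other turns `ν` into
`μ`. -/
lemma eLpNorm_rnDeriv_mul_le (hμν : μ ≪ ν) {R : ℝ≥0∞} (hR : ∀ᵐ v ∂ν, μ.rnDeriv ν v ≤ R)
    {h : Ω → ℝ} (hm : Measurable h) :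
    eLpNorm (fun v => (μ.rnDeriv ν v).toReal * h v) 2 ν ≤ R ^ (1 / 2 : ℝ) * eLpNorm h 2 μ := by
  refine le_mul_of_sq_le_sq_mul ?_
  rw [eLpNorm_two_sq, eLpNorm_two_sq,
    ← lintegral_rnDeriv_mul hμν (hm.enorm.pow_const 2).aemeasurable,
    ← lintegral_const_mul R
      (f := fun v => μ.rnDeriv ν v * ‖h v‖ₑ ^ 2)
      ((μ.measurable_rnDeriv ν).mul (hm.enorm.pow_const 2))]
  refine lintegral_mono_ae ?_
  filter_upwards [hR, μ.rnDeriv_lt_top ν] with v hv hv'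
  have : ‖(μ.rnDeriv ν v).toReal‖ₑ = μ.rnDeriv ν v := by
    rw [Real.enorm_eq_ofReal ENNReal.toReal_nonneg, ENNReal.ofReal_toReal hv'.ne]
  rw [enorm_mul, this, mul_pow, sq (μ.rnDeriv ν v), mul_assoc]
  gcongr

/-- Estimating `∫ h ∂μ` from a sample of `ν`, reweighted by the density `dμ/dν`. -/
lemma eLpNorm_importance_sampling_le {n : ℕ} (hn : 0 < n) (hμν : μ ≪ ν) {R : ℝ≥0∞}
    (hRtop : R ≠ ∞) (hR : ∀ᵐ v ∂ν, μ.rnDeriv ν v ≤ R) {h : Ω → ℝ} (hm : Measurable h)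
    (hh : MemLp h 2 μ) :
    eLpNorm (fun V : Fin n → Ω =>
        ∫ v, h v ∂μ - ∑ i, (n : ℝ)⁻¹ * ((μ.rnDeriv ν (V i)).toReal * h (V i))) 2
        (Measure.pi fun _ => ν) ≤
      ENNReal.ofReal ((n : ℝ) ^ (-(1 / 2) : ℝ)) * (R ^ (1 / 2 : ℝ) * eLpNorm h 2 μ) := by
  have hle := eLpNorm_rnDeriv_mul_le hμν hR hm
  have hF : MemLp (fun v => (μ.rnDeriv ν v).toReal * h v) 2 ν :=
    ⟨((μ.measurable_rnDeriv ν).ennreal_toReal.mul hm).aestronglyMeasurable,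
      hle.trans_lt (ENNReal.mul_lt_top
        (ENNReal.rpow_lt_top_of_nonneg (by norm_num) hRtop) hh.2)⟩
  have hint : ∫ v, (μ.rnDeriv ν v).toReal * h v ∂ν = ∫ v, h v ∂μ := by
    simpa [smul_eq_mul] using integral_rnDeriv_smul (f := h) hμν
  rw [← hint]
  exact (eLpNorm_mean_sub_le hn hF).trans (by gcongr)

end Sampling

/-! ### Reference measures -/

section Reference

variable {N d : ℕ}

lemma wasserstein1_le {ν₁ ν₂ : Measure (XN N d)} (γ : Measure (XN N d × XN N d))
    (h₁ : γ.map Prod.fst = ν₁) (h₂ : γ.map Prod.snd = ν₂) :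
    wasserstein1 ν₁ ν₂ ≤ ∫⁻ v, ENNReal.ofReal (euclNorm (v.1 - v.2)) ∂γ :=
  iInf₂_le γ ⟨h₁, h₂⟩

lemma measurable_euclNorm : Measurable (euclNorm : XN N d → ℝ) := by
  unfold euclNorm
  fun_prop

lemma measurable_euclNorm_sub :
    Measurable fun v : XN N d × XN N d => ENNReal.ofReal (euclNorm (v.1 - v.2)) :=
  (measurable_euclNorm.comp (measurable_fst.sub measurable_snd)).ennreal_ofReal

lemma lintegral_diagonal_cost (ν : Measure (XN N d)) :
    ∫⁻ v, ENNReal.ofReal (euclNorm (v.1 - v.2)) ∂(ν.map fun v => (v, v)) = 0 := by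
  rw [lintegral_map measurable_euclNorm_sub (by fun_prop)]
  simp [euclNorm]

lemma map_diagonal_fst (ν : Measure (XN N d)) : (ν.map fun v => (v, v)).map Prod.fst = ν := by
  rw [Measure.map_map measurable_fst (by fun_prop)]
  exact Measure.map_id

lemma map_diagonal_snd (ν : Measure (XN N d)) : (ν.map fun v => (v, v)).map Prod.snd = ν := by
  rw [Measure.map_map measurable_snd (by fun_prop)]
  exact Measure.map_id

lemma wasserstein1_self (ν : Measure (XN N d)) : wasserstein1 ν ν = 0 :=
  le_antisymm ((wasserstein1_le _ (map_diagonal_fst ν) (map_diagonal_snd ν)).trans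
    (lintegral_diagonal_cost ν).le) bot_le

/-- Mixing a share `ε` of `μ` into `ν` moves `ν` by at most `ε` times the distance to `μ`. -/
lemma wasserstein1_mixture_le (ν μ : Measure (XN N d)) {ε : ℝ≥0∞} (hε : ε ≤ 1) (hε0 : ε ≠ 0) :
    wasserstein1 ν ((1 - ε) • ν + ε • μ) ≤ ε * wasserstein1 ν μ := by
  have hεt : ε ≠ ∞ := ne_top_of_le_ne_top ENNReal.one_ne_top hε
  rw [mul_comm, ← ENNReal.div_le_iff_le_mul (Or.inl hε0) (Or.inl hεt)]
  refine le_iInf₂ fun γ hγ => ?_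
  rw [ENNReal.div_le_iff_le_mul (Or.inl hε0) (Or.inl hεt), mul_comm]
  -- The share `1 - ε` stays in place on the diagonal, and only the share `ε` is transported along
  -- `γ`.
  have h := wasserstein1_le (ν₁ := ν) (ν₂ := (1 - ε) • ν + ε • μ)
    ((1 - ε) • (ν.map fun v => (v, v)) + ε • γ)
    (by
      rw [Measure.map_add _ _ measurable_fst, Measure.map_smul, Measure.map_smul,
        map_diagonal_fst, hγ.1, ← add_smul, tsub_add_cancel_of_le hε, one_smul])
    (by
      rw [Measure.map_add _ _ measurable_snd, Measure.map_smul, Measure.map_smul,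
        map_diagonal_snd, hγ.2])
  refine h.trans (le_of_eq ?_)
  rw [lintegral_add_measure, lintegral_smul_measure, lintegral_smul_measure,
    lintegral_diagonal_cost]
  simp

lemma euclNorm_le_sum (v : XN N d) : euclNorm v ≤ |v.1| + ‖v.2.1‖ + ‖v.2.2.1‖ + |v.2.2.2| := by
  unfold euclNorm
  refine Real.sqrt_le_iff.mpr ⟨by positivity, ?_⟩
  have h1 := abs_nonneg v.1
  have h2 := norm_nonneg v.2.1
  have h3 := norm_nonneg v.2.2.1
  have h4 := abs_nonneg v.2.2.2
  rw [← sq_abs v.1, ← sq_abs v.2.2.2]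
  nlinarith [mul_nonneg h1 h2, mul_nonneg h1 h3, mul_nonneg h1 h4, mul_nonneg h2 h3,
    mul_nonneg h2 h4, mul_nonneg h3 h4]

lemma sum_le_euclNorm (v : XN N d) :
    |v.1| + ‖v.2.1‖ + ‖v.2.2.1‖ + |v.2.2.2| ≤ 4 * euclNorm v := by
  have h : ∀ t : ℝ, 0 ≤ t → t ^ 2 ≤ v.1 ^ 2 + ‖v.2.1‖ ^ 2 + ‖v.2.2.1‖ ^ 2 + v.2.2.2 ^ 2 →
      t ≤ euclNorm v := fun t _ h => Real.le_sqrt_of_sq_le h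
  have s1 := sq_nonneg v.1
  have s2 := sq_nonneg ‖v.2.1‖
  have s3 := sq_nonneg ‖v.2.2.1‖
  have s4 := sq_nonneg v.2.2.2
  have h1 := h |v.1| (abs_nonneg _) (by rw [sq_abs]; linarith)
  have h2 := h ‖v.2.1‖ (norm_nonneg _) (by linarith)
  have h3 := h ‖v.2.2.1‖ (norm_nonneg _) (by linarith)
  have h4 := h |v.2.2.2| (abs_nonneg _) (by rw [sq_abs]; linarith)
  linarith

/-- Measures with finite first moments are at finite distance. -/
lemma wasserstein1_lt_top {ν₁ ν₂ : Measure (XN N d)} [IsProbabilityMeasure ν₁]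
    [IsProbabilityMeasure ν₂] (h₁ : Integrable (fun v : XN N d => euclNorm v) ν₁)
    (h₂ : Integrable (fun v : XN N d => euclNorm v) ν₂) : wasserstein1 ν₁ ν₂ < ∞ := by
  refine (wasserstein1_le (ν₁.prod ν₂) (by simp) (by simp)).trans_lt ?_
  have hi : Integrable (fun v : XN N d × XN N d => 4 * euclNorm v.1 + 4 * euclNorm v.2)
      (ν₁.prod ν₂) :=
    ((h₁.comp_fst ν₂).const_mul 4).add ((h₂.comp_snd ν₁).const_mul 4)
  refine lt_of_le_of_lt (lintegral_mono fun v => ENNReal.ofReal_le_ofReal ?_)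
    hi.lintegral_lt_top
  refine (euclNorm_le_sum _).trans ?_
  have e1 := sum_le_euclNorm v.1
  have e2 := sum_le_euclNorm v.2
  have a1 := abs_sub v.1.1 v.2.1
  have a2 := norm_sub_le v.1.2.1 v.2.2.1
  have a3 := norm_sub_le v.1.2.2.1 v.2.2.2.1
  have a4 := abs_sub v.1.2.2.2 v.2.2.2.2
  simp only [Prod.fst_sub, Prod.snd_sub]
  linarith

lemma one_le_densityBound (μ ν : Measure (XN N d)) [IsProbabilityMeasure μ]
    [IsProbabilityMeasure ν] : 1 ≤ densityBound μ ν := by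
  unfold densityBound
  split_ifs with h
  · calc (1 : ℝ≥0∞) = ∫⁻ v, μ.rnDeriv ν v ∂ν := by
          rw [Measure.lintegral_rnDeriv h, measure_univ]
      _ ≤ ∫⁻ _, essSup (μ.rnDeriv ν) ν ∂ν := lintegral_mono_ae (ENNReal.ae_le_essSup _)
      _ = _ := by simp
  · exact le_top

/-- The mixture dominates `ε • μ`, hence `μ ≤ ε⁻¹ • κ` for the mixture `κ`, whatever `ν` is. -/
lemma rnDeriv_mixture_le (ν μ : Measure (XN N d)) [IsProbabilityMeasure μ]
    [IsProbabilityMeasure ν] {ε : ℝ≥0∞} (hε : ε ≤ 1) (hε0 : ε ≠ 0) :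
    μ ≪ (1 - ε) • ν + ε • μ ∧
      ∀ᵐ v ∂((1 - ε) • ν + ε • μ), μ.rnDeriv ((1 - ε) • ν + ε • μ) v ≤ ε⁻¹ := by
  have hεt : ε ≠ ∞ := ne_top_of_le_ne_top ENNReal.one_ne_top hε
  have h1t : 1 - ε ≠ ∞ := ne_top_of_le_ne_top ENNReal.one_ne_top tsub_le_self
  have hfin : IsFiniteMeasure ((1 - ε) • ν + ε • μ) := by
    constructor
    simp [hεt.lt_top, h1t.lt_top]
  set κ := (1 - ε) • ν + ε • μ
  have hle : ε • μ ≤ κ := Measure.le_add_left le_rfl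
  have hle' : μ ≤ ε⁻¹ • κ := by
    calc μ = ε⁻¹ • (ε • μ) := by
          rw [smul_smul, ENNReal.inv_mul_cancel hε0 hεt, one_smul]
      _ ≤ ε⁻¹ • κ := by gcongr
  refine ⟨(Measure.absolutelyContinuous_of_le hle').trans
    (Measure.smul_absolutelyContinuous), ?_⟩
  refine ae_le_of_forall_setLIntegral_le_of_sigmaFinite (μ.measurable_rnDeriv κ) fun s _ _ => ?_
  rw [setLIntegral_const]
  exact (Measure.setLIntegral_rnDeriv_le s).trans (by simpa using hle' s)

/-- A probability measure close to `ν` from which `μ` can be sampled efficiently. -/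
lemma exists_reference (ν μ : Measure (XN N d)) [IsProbabilityMeasure ν] [IsProbabilityMeasure μ]
    (hW : wasserstein1 ν μ ≠ ∞) {δ : ℝ} (hδ : δ ∈ Set.Ioo (0 : ℝ) 1) :
    ∃ ν' : Measure (XN N d), IsProbabilityMeasure ν' ∧ wasserstein1 ν ν' ≤ ENNReal.ofReal δ ∧
      μ ≪ ν' ∧ ∃ R : ℝ≥0∞, R ≠ ∞ ∧ (∀ᵐ v ∂ν', μ.rnDeriv ν' v ≤ R) ∧
        R ^ (1 / 2 : ℝ) ≤ (max 1 (wasserstein1 ν μ)) ^ (1 / 2 : ℝ) *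
          min (ENNReal.ofReal (δ ^ (-(1 / 2) : ℝ))) (densityBound μ ν ^ (1 / 2 : ℝ)) := by
  set m := max 1 (wasserstein1 ν μ)
  have hm1 : 1 ≤ m := le_max_left _ _
  have hm0 : m ≠ 0 := (zero_lt_one.trans_le hm1).ne'
  have hmt : m ≠ ∞ := max_ne_top ENNReal.one_ne_top hW
  have hδ0 : ENNReal.ofReal δ ≠ 0 := by simpa using hδ.1
  have hδpow : ENNReal.ofReal (δ ^ (-(1 / 2) : ℝ)) = (ENNReal.ofReal δ)⁻¹ ^ (1 / 2 : ℝ) := by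
    rw [← ENNReal.ofReal_rpow_of_pos hδ.1, ENNReal.rpow_neg, ENNReal.inv_rpow]
  have hm1' : 1 ≤ m ^ (1 / 2 : ℝ) := ENNReal.one_le_rpow hm1 (by norm_num)
  -- The minimum in the claim is attained by the density term exactly when `ν` can be kept
  -- unchanged.
  by_cases hD : densityBound μ ν ≤ (ENNReal.ofReal δ)⁻¹
  · have hDt : densityBound μ ν ≠ ∞ := ne_top_of_le_ne_top (by simpa using hδ.1) hD
    have hac : μ ≪ ν := by
      by_contra h
      exact hDt (by simp [densityBound, h])
    refine ⟨ν, inferInstance, by simp [wasserstein1_self], hac, densityBound μ ν, hDt, ?_, ?_⟩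
    · have : densityBound μ ν = essSup (μ.rnDeriv ν) ν := by simp [densityBound, hac]
      rw [this]
      exact ENNReal.ae_le_essSup _
    · have : densityBound μ ν ^ (1 / 2 : ℝ) ≤ ENNReal.ofReal (δ ^ (-(1 / 2) : ℝ)) := by
        rw [hδpow]
        exact ENNReal.rpow_le_rpow hD (by norm_num)
      rw [min_eq_right this]
      exact le_mul_of_one_le_left bot_le hm1'
  · have hle : ENNReal.ofReal δ / m ≤ 1 :=
      ENNReal.div_le_of_le_mul (by
        rw [one_mul]
        exact (ENNReal.ofReal_le_one.mpr hδ.2.le).trans hm1)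
    have hε0 : ENNReal.ofReal δ / m ≠ 0 := ENNReal.div_ne_zero.mpr ⟨hδ0, hmt⟩
    set ε := ENNReal.ofReal δ / m
    obtain ⟨hac, hR⟩ := rnDeriv_mixture_le ν μ hle hε0
    refine ⟨(1 - ε) • ν + ε • μ, ⟨?_⟩, ?_, hac, ε⁻¹, ENNReal.inv_ne_top.mpr hε0, hR, ?_⟩
    · simp [tsub_add_cancel_of_le hle]
    · refine (wasserstein1_mixture_le ν μ hle hε0).trans ?_
      calc ε * wasserstein1 ν μ ≤ ε * m := by gcongr; exact le_max_right _ _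
        _ = ENNReal.ofReal δ := ENNReal.div_mul_cancel hm0 hmt
    · have h1 : ENNReal.ofReal (δ ^ (-(1 / 2) : ℝ)) ≤ densityBound μ ν ^ (1 / 2 : ℝ) := by
        rw [hδpow]
        exact ENNReal.rpow_le_rpow (not_le.mp hD).le (by norm_num)
      rw [min_eq_left h1, hδpow, ← ENNReal.mul_rpow_of_nonneg _ _ (by norm_num),
        ENNReal.inv_div (Or.inl hmt) (Or.inl hm0), div_eq_mul_inv]

end Reference

/-! ### Constants -/

section Constants

variable {N d : ℕ} {p q : ℝ≥0∞} [Fact (1 ≤ q)]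

variable (p) in
/-- The factor of `approxConst` that depends on the state equation. -/
noncomputable def systemGain (lam : ℝ) (S : StateSystem q d) : ℝ :=
  max (max (‖S.C‖ / (1 - ‖lam⁻¹ • S.A‖ ^ p.toReal) ^ (1 / p.toReal)) (‖S.B‖ / (1 - ‖S.A‖))) 1

/-- The factor of `approxConst` that depends on the network is `1 + E.networkGain lam`. -/
noncomputable def ESN.networkGain [NeZero d] (lam : ℝ) (E : ESN N d) : ℝ :=
  (‖E.C‖ + ‖E.B‖) / (1 - ‖E.A‖) * ‖E.transfer lam‖

/-- The bound `M / (1 - lam) + 1` on the states, relative to the system gain. -/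
noncomputable def stateConst (M lam : ℝ) : ℝ := M / (1 - lam) + 1

/-- The constant in the bound on the truncation error. -/
noncomputable def truncConst (d : ℕ) (M lam : ℝ) : ℝ :=
  6 * d ^ 2 * ((d + 1) * (M + 1)) + lam⁻¹ * (d * M + 1 + stateConst M lam)

lemma one_le_systemGain (lam : ℝ) (S : StateSystem q d) : 1 ≤ systemGain p lam S :=
  le_max_right _ _

lemma bias_le_systemGain (lam : ℝ) (S : StateSystem q d) :
    ‖S.B‖ / (1 - ‖S.A‖) ≤ systemGain p lam S :=
  (le_max_right _ _).trans (le_max_left _ _)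

/-- The denominator below `‖S.C‖` lies in `(0, 1]`, so dividing by it only enlarges. -/
lemma norm_C_le_systemGain [Fact (1 ≤ p)] (hp : p < ∞) {lam : ℝ} (hlam : 0 < lam)
    {S : StateSystem q d} (hS : ‖S.A‖ < lam) : ‖S.C‖ ≤ systemGain p lam S := by
  refine le_trans ?_ ((le_max_left _ _).trans (le_max_left _ _))
  have hp0 : 0 < p.toReal := ENNReal.toReal_pos
    (zero_lt_one.trans_le (Fact.out : 1 ≤ p)).ne' hp.ne
  have h1 : ‖lam⁻¹ • S.A‖ < 1 := by
    rw [norm_smul, Real.norm_of_nonneg (by positivity), inv_mul_lt_iff₀ hlam, mul_one]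
    exact hS
  have h2 : ‖lam⁻¹ • S.A‖ ^ p.toReal < 1 := Real.rpow_lt_one (norm_nonneg _) h1 hp0
  have h3 : 0 ≤ ‖lam⁻¹ • S.A‖ ^ p.toReal := by positivity
  rw [le_div_iff₀ (Real.rpow_pos_of_pos (by linarith) _)]
  exact mul_le_of_le_one_right (norm_nonneg _)
    (Real.rpow_le_one (by linarith) (by linarith) (by positivity))

lemma state_bound_le [Fact (1 ≤ p)] (hp : p < ∞) {lam : ℝ} (hlam : lam ∈ Set.Ioo (0 : ℝ) 1)
    {S : StateSystem q d} (hS : ‖S.A‖ < lam) {M : ℝ} (hM : 0 ≤ M) :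
    (‖S.C‖ * M + ‖S.B‖) / (1 - ‖S.A‖) ≤ stateConst M lam * systemGain p lam S := by
  have h0 : 0 < 1 - lam := by linarith [hlam.2]
  have hC := norm_C_le_systemGain (p := p) hp hlam.1 hS
  have hG := one_le_systemGain (p := p) lam S
  have h1 : ‖S.C‖ * M / (1 - ‖S.A‖) ≤ systemGain p lam S * M / (1 - lam) := by
    gcongr
  rw [add_div]
  calc _ ≤ systemGain p lam S * M / (1 - lam) + systemGain p lam S :=
        add_le_add h1 (bias_le_systemGain lam S)
    _ = _ := by rw [stateConst]; ring

lemma stateConst_nonneg {M lam : ℝ} (hM : 0 ≤ M) (hlam : lam ∈ Set.Ioo (0 : ℝ) 1) :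
    0 ≤ stateConst M lam := by
  have h0 : 0 < 1 - lam := by linarith [hlam.2]
  unfold stateConst
  positivity

lemma truncConst_nonneg {M lam : ℝ} (hM : 0 ≤ M) (hlam : lam ∈ Set.Ioo (0 : ℝ) 1) :
    0 ≤ truncConst d M lam := by
  have h1 := stateConst_nonneg hM hlam
  have h2 := hlam.1
  unfold truncConst
  positivity

/-- Consequently a gain below `√N` forces `‖E.A‖ ≤ 1 - N^{-1/2}`. -/
lemma inv_le_networkGain [NeZero d] (hN : 0 < N) {E : ESN N d} (hE : ‖E.A‖ < 1)
    (hK : IsUnit E.controllability) (lam : ℝ) : (1 - ‖E.A‖)⁻¹ ≤ E.networkGain lam := by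
  have h1 : 0 < 1 - ‖E.A‖ := by linarith
  have h2 := one_le_norm_transfer_mul_norm hN hK lam
  have h3 : 0 ≤ ‖E.B‖ * ‖E.transfer lam‖ := by positivity
  rw [ESN.networkGain, div_mul_eq_mul_div, inv_eq_one_div]
  gcongr
  linarith

lemma networkGain_nonneg [NeZero d] {E : ESN N d} (hE : ‖E.A‖ < 1) (lam : ℝ) :
    0 ≤ E.networkGain lam := by
  have h1 : 0 < 1 - ‖E.A‖ := by linarith
  unfold ESN.networkGain
  positivity

/-- A contraction rate separated from `1` by `N^{-1/2}` decays quickly in `N / d` steps. -/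
lemma sqrt_mul_pow_le {ρ t : ℝ} (hρ : 0 ≤ ρ) (ht : 1 ≤ t) (hρt : ρ ≤ 1 - t⁻¹) {T : ℕ}
    {d : ℝ} (hd : 0 < d) (hT : t ^ 2 ≤ (T + 1) * d) : t * ρ ^ T ≤ 6 * d ^ 2 * t⁻¹ := by
  have ht0 : 0 < t := by linarith
  have h1 : ρ ≤ Real.exp (-t⁻¹) := hρt.trans (by linarith [Real.add_one_le_exp (-t⁻¹)])
  -- Passing from `T + 1` to `T` steps costs at most the factor `exp 1`, since `t⁻¹ ≤ 1`.
  have h2 : ρ ^ T ≤ Real.exp (1 - t / d) := by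
    refine (pow_le_pow_left₀ hρ h1 T).trans ?_
    rw [← Real.exp_nat_mul]
    refine Real.exp_le_exp.mpr ?_
    have h3 : t / d ≤ (T + 1) * t⁻¹ := by
      rw [div_le_iff₀ hd, ← div_eq_mul_inv, div_mul_eq_mul_div, le_div_iff₀ ht0]
      linarith
    have h4 : t⁻¹ ≤ 1 := inv_le_one_of_one_le₀ ht
    linarith
  -- With `s = t / d`, `s ^ 2 / 2 ≤ exp s` leaves `exp 1 ≤ 3`; together with the `2 * d ^ 2` split
  -- off below this gives `6 * d ^ 2`.
  have h3 : (t / d) ^ 2 / 2 * Real.exp (1 - t / d) ≤ 3 := by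
    have h4 := Real.quadratic_le_exp_of_nonneg (x := t / d) (by positivity)
    have h5 : (t / d) ^ 2 / 2 ≤ Real.exp (t / d) := by
      have : 0 ≤ t / d := by positivity
      linarith
    calc _ ≤ Real.exp (t / d) * Real.exp (1 - t / d) := by gcongr
      _ = Real.exp 1 := by rw [← Real.exp_add]; congr 1; ring
      _ ≤ 3 := by linarith [Real.exp_one_lt_d9]
  calc t * ρ ^ T ≤ t * Real.exp (1 - t / d) := by gcongr
    _ = (t / d) ^ 2 / 2 * Real.exp (1 - t / d) * (2 * d ^ 2 * t⁻¹) := by field_simp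
    _ ≤ 3 * (2 * d ^ 2 * t⁻¹) := by gcongr
    _ = _ := by ring

end Constants

/-! ### Truncation error -/

section Truncation

variable {N d : ℕ} [NeZero d] {p q : ℝ≥0∞} [Fact (1 ≤ p)] [Fact (1 ≤ q)]
  [ENNReal.HolderConjugate p q]

/-- In the small-gain regime `hX`, the network tail, including the `√N` from `‖θ(a)‖`, goes into
`N^{-1/2}`, and the system tail goes into `lam ^ (N / d)`. -/
lemma abs_transferred_sub_le_gain (hp : p < ∞) {lam : ℝ} (hlam : lam ∈ Set.Ioo (0 : ℝ) 1)
    {S : StateSystem q d} (hS : ‖S.A‖ < lam) (hN : 0 < N) {E : ESN N d} (hE : ‖E.A‖ < 1)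
    (hK : IsUnit E.controllability) (hX : E.networkGain lam < √N) {z : PastSeq (Vec d)} {M : ℝ}
    (hM : 0 ≤ M) (hz : ∀ n, ‖z n‖ ≤ M) {x : PastSeq (EllP q)} (hx : S.IsSolution id z x)
    {y : PastSeq (Vec N)} (hy : E.IsSolution id z y) (a : EllP p) :
    |inner ℝ (transferredWeight lam S E a) (y 1)
        + (-inner ℝ (transferredWeight lam S E a) E.biasSum
          + pairing a (∑' k : ℕ, (S.A ^ k) S.B)) - pairing a (x 1)| ≤
      truncConst d M lam * (systemGain p lam S * (1 + E.networkGain lam)) *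
        (lam ^ ((N : ℝ) / (d : ℝ)) + (N : ℝ) ^ (-(1 / 2) : ℝ)) * ‖a‖ := by
  have hd : (0 : ℝ) < d := by exact_mod_cast Nat.pos_of_ne_zero (NeZero.ne d)
  have hN' : (0 : ℝ) < N := by exact_mod_cast hN
  obtain ⟨T, hT⟩ : ∃ T, ⌈(N : ℝ) / (d : ℝ)⌉₊ = T + 1 :=
    Nat.exists_eq_succ_of_ne_zero (Nat.ceil_pos.mpr (by positivity)).ne'
  have hTd : (N : ℝ) / d ≤ T + 1 := by
    have := Nat.le_ceil ((N : ℝ) / d)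
    rw [hT] at this
    exact_mod_cast this
  refine (abs_transferred_sub_le hlam hS hE hK hz hx hy hT a).trans ?_
  set G := systemGain p lam S
  set Y := E.networkGain lam with hY
  have hG : 1 ≤ G := one_le_systemGain lam S
  have hCG : ‖S.C‖ ≤ G := norm_C_le_systemGain hp hlam.1 hS
  have hBG : ‖S.B‖ / (1 - ‖S.A‖) ≤ G := bias_le_systemGain lam S
  have hxG := state_bound_le (p := p) hp hlam hS hM
  have hY0 : 0 ≤ Y := networkGain_nonneg hE lam
  have hE1 : 0 < 1 - ‖E.A‖ := by linarith
  have hS1 : 0 < 1 - ‖S.A‖ := by linarith [hlam.2]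
  have hsc := stateConst_nonneg hM hlam
  have hlam0 := hlam.1
  have hrpow : (N : ℝ) ^ (-(1 / 2) : ℝ) = (√N)⁻¹ := by
    rw [Real.rpow_neg hN'.le, Real.sqrt_eq_rpow]
  set r := (N : ℝ) ^ (-(1 / 2) : ℝ)
  set l := lam ^ ((N : ℝ) / (d : ℝ))
  have hr : 0 ≤ r := by positivity
  have hl : 0 ≤ l := by positivity
  have hsqrt : 1 ≤ √(N : ℝ) := Real.one_le_sqrt.mpr (by exact_mod_cast hN)
  have hρ : √N * ‖E.A‖ ^ T ≤ 6 * (d : ℝ) ^ 2 * r := by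
    rw [hrpow]
    refine sqrt_mul_pow_le (norm_nonneg _) hsqrt ?_ hd ?_
    · have h1 : (1 - ‖E.A‖)⁻¹ ≤ √N := (inv_le_networkGain hN hE hK lam).trans hX.le
      have h2 : (√(N : ℝ))⁻¹ ≤ 1 - ‖E.A‖ := inv_le_of_inv_le₀ hE1 h1
      linarith
    · rw [Real.sq_sqrt hN'.le]
      exact (div_le_iff₀ hd).mp hTd
  -- The exponent `N / d` is only known to be at most `T + 1`; the missing step is paid for by
  -- `lam⁻¹`.
  have hαT : ‖S.A‖ ^ T ≤ lam⁻¹ * l := by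
    have h1 : lam ^ (T + 1) ≤ l := by
      rw [← Real.rpow_natCast]
      exact Real.rpow_le_rpow_of_exponent_ge hlam.1 hlam.2.le (by exact_mod_cast hTd)
    calc ‖S.A‖ ^ T ≤ lam ^ T := pow_le_pow_left₀ (norm_nonneg _) hS.le T
      _ = lam⁻¹ * lam ^ (T + 1) := by rw [pow_succ]; field_simp
      _ ≤ lam⁻¹ * l := by gcongr
  have hαT' : ‖S.A‖ ^ (T + 1) ≤ lam⁻¹ * l :=
    (pow_le_pow_of_le_one (norm_nonneg _) (by linarith) (Nat.le_succ T)).trans hαT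
  have hρT' : ‖E.A‖ ^ (T + 1) ≤ ‖E.A‖ ^ T :=
    pow_le_pow_of_le_one (norm_nonneg _) hE.le (Nat.le_succ T)
  have part1 : ‖transferredWeight lam S E a‖ * (d * (M * (‖E.A‖ ^ T * ‖E.C‖))
        + ‖E.A‖ ^ (T + 1) * ((‖E.C‖ * M + ‖E.B‖) / (1 - ‖E.A‖))) ≤
      6 * d ^ 2 * ((d + 1) * (M + 1)) * (G * Y) * r * ‖a‖ := by
    have h1 : d * (M * (‖E.A‖ ^ T * ‖E.C‖))
        + ‖E.A‖ ^ (T + 1) * ((‖E.C‖ * M + ‖E.B‖) / (1 - ‖E.A‖)) ≤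
        ‖E.A‖ ^ T * ((d + 1) * (M + 1) * ((‖E.C‖ + ‖E.B‖) / (1 - ‖E.A‖))) := by
      have hCE : ‖E.C‖ ≤ (‖E.C‖ + ‖E.B‖) / (1 - ‖E.A‖) := by
        rw [le_div_iff₀ hE1]
        have := mul_nonneg (norm_nonneg E.C) (norm_nonneg E.A)
        linarith [norm_nonneg E.B]
      have hUE : (‖E.C‖ * M + ‖E.B‖) / (1 - ‖E.A‖) ≤
          (M + 1) * ((‖E.C‖ + ‖E.B‖) / (1 - ‖E.A‖)) := by
        rw [← mul_div_assoc]
        gcongr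
        have := mul_nonneg hM (norm_nonneg E.B)
        linarith [norm_nonneg E.C]
      set V := (‖E.C‖ + ‖E.B‖) / (1 - ‖E.A‖)
      have hV : 0 ≤ V := (norm_nonneg _).trans hCE
      calc _ ≤ d * (M * (‖E.A‖ ^ T * V)) + ‖E.A‖ ^ T * ((M + 1) * V) := by
            gcongr
        _ ≤ d * ((M + 1) * (‖E.A‖ ^ T * V)) + ‖E.A‖ ^ T * ((M + 1) * V) := by
            gcongr
            linarith
        _ = _ := by ring
    calc _ ≤ ‖E.transfer lam‖ * (√N * (‖a‖ * ‖S.C‖)) *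
          (‖E.A‖ ^ T * ((d + 1) * (M + 1) * ((‖E.C‖ + ‖E.B‖) / (1 - ‖E.A‖)))) := by
          refine mul_le_mul (norm_transferredWeight_le hlam.1 hS E a) h1 ?_ ?_ <;> positivity
      _ = (√N * ‖E.A‖ ^ T) * (‖S.C‖ * ((d + 1) * (M + 1) * Y * ‖a‖)) := by
          rw [hY, ESN.networkGain]
          ring
      _ ≤ (6 * d ^ 2 * r) * (G * ((d + 1) * (M + 1) * Y * ‖a‖)) := by
          gcongr
      _ = _ := by ring
  have part2 : d * (M * (‖S.A‖ ^ T * ‖S.C‖)) + ‖S.A‖ ^ (T + 1) * (‖S.B‖ / (1 - ‖S.A‖))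
        + ‖S.A‖ ^ (T + 1) * ((‖S.C‖ * M + ‖S.B‖) / (1 - ‖S.A‖)) ≤
      lam⁻¹ * (d * M + 1 + stateConst M lam) * G * l := by
    calc _ ≤ d * (M * (lam⁻¹ * l * G)) + lam⁻¹ * l * G
          + lam⁻¹ * l * (stateConst M lam * G) := by
          gcongr
      _ = _ := by ring
  calc _ ≤ 6 * d ^ 2 * ((d + 1) * (M + 1)) * (G * Y) * r * ‖a‖
        + ‖a‖ * (lam⁻¹ * (d * M + 1 + stateConst M lam) * G * l) := by
        gcongr
    _ ≤ 6 * d ^ 2 * ((d + 1) * (M + 1)) * (G * (1 + Y)) * (l + r) * ‖a‖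
        + lam⁻¹ * (d * M + 1 + stateConst M lam) * (G * (1 + Y)) * (l + r) * ‖a‖ := by
        have e1 : G * Y ≤ G * (1 + Y) := by gcongr; linarith
        have e2 : G ≤ G * (1 + Y) := le_mul_of_one_le_right (by linarith) (by linarith)
        have e3 : r ≤ l + r := by linarith
        have e4 : l ≤ l + r := by linarith
        rw [mul_comm ‖a‖]
        gcongr
    _ = _ := by rw [truncConst]; ring

end Truncation

/-! ### Integrals -/

section Integrals

variable {N d : ℕ} {p q : ℝ≥0∞} [Fact (1 ≤ p)] [Fact (1 ≤ q)]

/-- The factor `2` comes from `(α + β + γ + 1) ^ 2 ≤ 4 * (α ^ 2 + β ^ 2 + γ ^ 2 + 1)`. -/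
lemma eLpNorm_two_le_of_growth {μ : Measure (X p d)}
    (hμ : Integrable (fun v : X p d => secondOrderIntegrand v) μ) {u : X p d → ℝ} {κ : ℝ}
    (hκ : 0 ≤ κ)
    (hu : ∀ v, |u v| ≤ κ * (|v.1| * (‖v.2.1‖ + ‖v.2.2.1‖ + |v.2.2.2| + 1))) :
    eLpNorm u 2 μ ≤ ENNReal.ofReal (2 * κ * secondOrderIntegral μ) := by
  have hs : 0 ≤ secondOrderIntegral μ := Real.sqrt_nonneg _
  rw [← ENNReal.pow_le_pow_left_iff two_ne_zero, eLpNorm_two_sq,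
    ← ENNReal.ofReal_pow (by positivity)]
  have hn : ∀ v : X p d, 0 ≤ secondOrderIntegrand v := fun v => by
    unfold secondOrderIntegrand
    positivity
  have h1 : (2 * κ * secondOrderIntegral μ) ^ 2 =
      ∫ v : X p d, (2 * κ) ^ 2 * secondOrderIntegrand v ∂μ := by
    rw [mul_pow, secondOrderIntegral, Real.sq_sqrt (integral_nonneg hn), integral_const_mul]
  rw [h1, ofReal_integral_eq_lintegral_ofReal (hμ.const_mul _)
    (ae_of_all _ fun v => mul_nonneg (by positivity) (hn v))]
  refine lintegral_mono fun v => ?_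
  rw [Real.enorm_eq_ofReal_abs, ← ENNReal.ofReal_pow (abs_nonneg _)]
  refine ENNReal.ofReal_le_ofReal ((pow_le_pow_left₀ (abs_nonneg _) (hu v) 2).trans ?_)
  rw [mul_pow, mul_pow, sq_abs, secondOrderIntegrand, mul_pow, mul_comm (2 ^ 2 : ℝ), mul_assoc]
  refine mul_le_mul_of_nonneg_left ?_ (sq_nonneg _)
  rw [← mul_assoc, mul_comm (2 ^ 2 : ℝ), mul_assoc]
  refine mul_le_mul_of_nonneg_left ?_ (sq_nonneg _)
  generalize ‖v.2.1‖ = α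
  generalize ‖v.2.2.1‖ = β
  generalize |v.2.2.2| = γ
  nlinarith [sq_nonneg (α - β), sq_nonneg (α - γ), sq_nonneg (α - 1), sq_nonneg (β - γ),
    sq_nonneg (β - 1), sq_nonneg (γ - 1)]

variable [NeZero d] [ENNReal.HolderConjugate p q]

lemma measurable_transferredWeight (lam : ℝ) (S : StateSystem q d) (E : ESN N d) :
    Measurable fun a : EllP p => transferredWeight lam S E a := by
  refine (WithLp.measurable_toLp 2 (Fin N → ℝ)).comp (measurable_pi_lambda _ fun i => ?_)
  simp only [Matrix.mulVec, dotProduct]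
  exact Finset.measurable_sum _ fun j _ => (measurable_pairing_left _).const_mul _

lemma measurable_weightMap (lam : ℝ) (S : StateSystem q d) (E : ESN N d) :
    Measurable (weightMap lam S E : X p d → XN N d) := by
  have h1 : Measurable fun v : X p d => transferredWeight lam S E v.2.1 :=
    (measurable_transferredWeight lam S E).comp (by fun_prop)
  have h2 : Measurable fun v : X p d => pairing v.2.1 (∑' k : ℕ, (S.A ^ k) S.B) :=
    (measurable_pairing_left _).comp (by fun_prop)
  unfold weightMap
  fun_prop

/-- The map `weightMap` grows at most linearly, so first moments survive. This makes the Wasserstein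
distance to `ν₀` finite, hence the share mixed in by `exists_reference` nonzero. -/
lemma integrable_euclNorm_inducedMeasure {lam : ℝ} (hlam : 0 < lam) {S : StateSystem q d}
    (hS : ‖S.A‖ < lam) (E : ESN N d) {μ : Measure (X p d)}
    (hμ : Integrable (fun v : X p d => |v.1| + ‖v.2.1‖ + ‖v.2.2.1‖ + |v.2.2.2|) μ) :
    Integrable (fun v : XN N d => euclNorm v) (inducedMeasure lam S E μ) := by
  have hψ := measurable_weightMap (p := p) lam S E
  rw [inducedMeasure, integrable_map_measure measurable_euclNorm.aestronglyMeasurable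
    hψ.aemeasurable]
  set t := ‖E.transfer lam‖ * (√N * ‖S.C‖)
  set β := ‖∑' k : ℕ, (S.A ^ k) S.B‖
  have ht : 0 ≤ t := by positivity
  have hβ : 0 ≤ β := norm_nonneg _
  refine (hμ.const_mul (1 + t + t * ‖E.biasSum‖ + β)).mono'
    (measurable_euclNorm.comp hψ).aestronglyMeasurable (ae_of_all _ fun v => ?_)
  rw [Function.comp_apply, Real.norm_of_nonneg
    (show 0 ≤ euclNorm (weightMap lam S E v) from Real.sqrt_nonneg _)]
  refine (euclNorm_le_sum _).trans ?_
  have h1 : ‖transferredWeight lam S E v.2.1‖ ≤ t * ‖v.2.1‖ :=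
    (norm_transferredWeight_le hlam hS E v.2.1).trans (le_of_eq (by ring))
  have h2 : |-inner ℝ (transferredWeight lam S E v.2.1) E.biasSum
      + pairing v.2.1 (∑' k : ℕ, (S.A ^ k) S.B) + v.2.2.2| ≤
      t * ‖v.2.1‖ * ‖E.biasSum‖ + ‖v.2.1‖ * β + |v.2.2.2| := by
    refine (abs_add_le _ _).trans (add_le_add_left ((abs_add_le _ _).trans
      (add_le_add ?_ (abs_pairing_le _ _))) _)
    rw [abs_neg]
    exact (abs_real_inner_le_norm _ _).trans (mul_le_mul_of_nonneg_right h1 (norm_nonneg _))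
  simp only [weightMap]
  have n1 := abs_nonneg v.1
  have n2 := norm_nonneg v.2.1
  have n3 := norm_nonneg v.2.2.1
  have n4 := abs_nonneg v.2.2.2
  have n5 : 0 ≤ t * ‖E.biasSum‖ := by positivity
  have n6 : 0 ≤ (t + t * ‖E.biasSum‖ + β) * (|v.1| + ‖v.2.2.1‖ + |v.2.2.2|) := by positivity
  nlinarith [h1, h2]

end Integrals

/-! ### Mean square error of the sampled readout. -/

section Approximation

variable {N d : ℕ} [NeZero d] {p q : ℝ≥0∞} [Fact (1 ≤ p)] [Fact (1 ≤ q)]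
  [ENNReal.HolderConjugate p q]

lemma abs_lipschitz_le {σ : ℝ → ℝ} {L : ℝ≥0} (hσ : LipschitzWith L σ) (t : ℝ) :
    |σ t| ≤ L * |t| + |σ 0| := by
  have h := hσ.dist_le_mul t 0
  rw [Real.dist_eq, Real.dist_eq, sub_zero] at h
  have h2 := abs_add_le (σ t - σ 0) (σ 0)
  rw [sub_add_cancel] at h2
  linarith

/-- The weight of one hidden neuron times its activation. -/
noncomputable def neuron (σ : ℝ → ℝ) (y : Vec N) (z₀ : Vec d) (v : XN N d) : ℝ :=
  v.1 * σ (inner ℝ v.2.1 y + inner ℝ v.2.2.1 z₀ + v.2.2.2)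

/-- The integrand in the definition of a recurrent Barron functional. -/
noncomputable def barronIntegrand (σ : ℝ → ℝ) (x : EllP q) (z₀ : Vec d) (v : X p d) : ℝ :=
  v.1 * σ (pairing v.2.1 x + inner ℝ v.2.2.1 z₀ + v.2.2.2)

omit [NeZero d] in
lemma measurable_neuron {σ : ℝ → ℝ} (hσ : Measurable σ) (y : Vec N) (z₀ : Vec d) :
    Measurable (neuron σ y z₀) := by
  unfold neuron
  exact measurable_fst.mul (hσ.comp (by fun_prop))

omit [NeZero d] in
lemma measurable_barronIntegrand {σ : ℝ → ℝ} (hσ : Measurable σ) (x : EllP q) (z₀ : Vec d) :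
    Measurable (barronIntegrand σ x z₀ : X p d → ℝ) := by
  have h : Measurable fun v : X p d => pairing v.2.1 x :=
    (measurable_pairing_left x).comp (by fun_prop)
  unfold barronIntegrand
  exact measurable_fst.mul (hσ.comp (by fun_prop))

omit [NeZero d] in
/-- Growth of an activation whose argument is an affine function of `(a, c, b)` up to an error
proportional to `‖a‖`. -/
lemma abs_mul_activation_le {σ : ℝ → ℝ} {L : ℝ≥0} (hσ : LipschitzWith L σ) {x : EllP q}
    {z₀ : Vec d} {r M τ s : ℝ} (hx : ‖x‖ ≤ r) (hz : ‖z₀‖ ≤ M) (hτ : 0 ≤ τ) (v : X p d)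
    (hs : |s - pairing v.2.1 x| ≤ τ * ‖v.2.1‖) :
    |v.1 * σ (s + inner ℝ v.2.2.1 z₀ + v.2.2.2)| ≤
      (L * (r + τ + M + 1) + |σ 0|) * (|v.1| * (‖v.2.1‖ + ‖v.2.2.1‖ + |v.2.2.2| + 1)) := by
  have hr : 0 ≤ r := (norm_nonneg _).trans hx
  have hM : 0 ≤ M := (norm_nonneg _).trans hz
  have h1 : |pairing v.2.1 x| ≤ ‖v.2.1‖ * r :=
    (abs_pairing_le _ _).trans (mul_le_mul_of_nonneg_left hx (norm_nonneg _))
  have h2 : |inner ℝ v.2.2.1 z₀| ≤ ‖v.2.2.1‖ * M :=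
    (abs_real_inner_le_norm _ _).trans (mul_le_mul_of_nonneg_left hz (norm_nonneg _))
  have h3 : |s + inner ℝ v.2.2.1 z₀ + v.2.2.2| ≤
      (r + τ + M + 1) * (‖v.2.1‖ + ‖v.2.2.1‖ + |v.2.2.2| + 1) := by
    have e1 := abs_add_le (s + inner ℝ v.2.2.1 z₀) v.2.2.2
    have e2 := abs_add_le s (inner ℝ v.2.2.1 z₀)
    have e3 := abs_add_le (s - pairing v.2.1 x) (pairing v.2.1 x)
    rw [sub_add_cancel] at e3
    have n1 := norm_nonneg v.2.1
    have n2 := norm_nonneg v.2.2.1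
    have n3 := abs_nonneg v.2.2.2
    have m1 : 0 ≤ (M + 1) * (‖v.2.1‖ + 1) := by positivity
    have m2 : 0 ≤ (r + τ + 1) * (‖v.2.2.1‖ + 1) := by positivity
    have m3 : 0 ≤ (r + τ + M) * (|v.2.2.2| + 1) := by positivity
    have m4 : 0 ≤ (r + τ + M) := by positivity
    nlinarith
  have h4 := abs_lipschitz_le hσ (s + inner ℝ v.2.2.1 z₀ + v.2.2.2)
  have h5 : 1 ≤ ‖v.2.1‖ + ‖v.2.2.1‖ + |v.2.2.2| + 1 := by
    have : 0 ≤ ‖v.2.1‖ + ‖v.2.2.1‖ + |v.2.2.2| := by positivity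
    linarith
  rw [abs_mul]
  calc _ ≤ |v.1| * (L * ((r + τ + M + 1) * (‖v.2.1‖ + ‖v.2.2.1‖ + |v.2.2.2| + 1))
          + |σ 0| * (‖v.2.1‖ + ‖v.2.2.1‖ + |v.2.2.2| + 1)) := by
        refine mul_le_mul_of_nonneg_left (h4.trans (add_le_add ?_ ?_)) (abs_nonneg _)
        · exact mul_le_mul_of_nonneg_left h3 L.2
        · exact le_mul_of_one_le_right (abs_nonneg _) h5
    _ = _ := by ring

omit [Fact (1 ≤ p)] [p.HolderConjugate q] in
lemma neuron_weightMap (σ : ℝ → ℝ) (lam : ℝ) (S : StateSystem q d) (E : ESN N d) (y : Vec N)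
    (z₀ : Vec d) (v : X p d) :
    neuron σ y z₀ (weightMap lam S E v) =
      v.1 * σ ((inner ℝ (transferredWeight lam S E v.2.1) y
        + (-inner ℝ (transferredWeight lam S E v.2.1) E.biasSum
          + pairing v.2.1 (∑' k : ℕ, (S.A ^ k) S.B))) + inner ℝ v.2.2.1 z₀ + v.2.2.2) := by
  simp only [neuron, weightMap]
  congr 2
  ring

/-- The sampling estimator of `H` built from hidden weights with law `ν`. -/
noncomputable def samplingReadout (μ' ν : Measure (XN N d)) (V : Fin N → XN N d) (i : Fin N) : ℝ :=
  (N : ℝ)⁻¹ * ((μ'.rnDeriv ν (V i)).toReal * (V i).1)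

omit [NeZero d] in
lemma measurable_samplingReadout (μ' ν : Measure (XN N d)) :
    Measurable (samplingReadout μ' ν) := by
  refine measurable_pi_lambda _ fun i => ?_
  have h := (μ'.measurable_rnDeriv ν).ennreal_toReal.comp
    (measurable_pi_apply (X := fun _ => XN N d) i)
  exact (h.mul (measurable_fst.comp (measurable_pi_apply i))).const_mul _

omit [NeZero d] in
lemma elmOutput_samplingReadout (σ : ℝ → ℝ) (μ' ν : Measure (XN N d)) (V : Fin N → XN N d)
    (y : PastSeq (Vec N)) (z : PastSeq (Vec d)) :
    elmOutput σ (samplingReadout μ' ν V) V y z =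
      ∑ i, (N : ℝ)⁻¹ * ((μ'.rnDeriv ν (V i)).toReal * neuron σ (y 1) (z 0) (V i)) := by
  refine Finset.sum_congr rfl fun i _ => ?_
  simp only [samplingReadout, neuron]
  ring

/-- Mean square error of the sampling estimator, given the truncation error `τ`. -/
lemma eLpNorm_samplingReadout_le {σ : ℝ → ℝ} {L : ℝ≥0} (hσ : LipschitzWith L σ) (hN : 0 < N)
    {lam : ℝ} {S : StateSystem q d} {E : ESN N d} {μ : Measure (X p d)} [IsProbabilityMeasure μ]
    (hI : Integrable (fun v : X p d => |v.1| * (‖v.2.1‖ + ‖v.2.2.1‖ + |v.2.2.2|)) μ)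
    (hI2 : Integrable (fun v : X p d => secondOrderIntegrand v) μ)
    {x : PastSeq (EllP q)} {y : PastSeq (Vec N)} {z : PastSeq (Vec d)} {r M τ : ℝ}
    (hx : ‖x 1‖ ≤ r) (hz : ‖z 0‖ ≤ M) (hτ : 0 ≤ τ)
    (htrunc : ∀ a : EllP p, |inner ℝ (transferredWeight lam S E a) (y 1)
        + (-inner ℝ (transferredWeight lam S E a) E.biasSum
          + pairing a (∑' k : ℕ, (S.A ^ k) S.B)) - pairing a (x 1)| ≤ τ * ‖a‖)
    {ν : Measure (XN N d)} [IsProbabilityMeasure ν] (hac : inducedMeasure lam S E μ ≪ ν)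
    {R : ℝ≥0∞} (hRt : R ≠ ∞)
    (hR : ∀ᵐ v ∂ν, (inducedMeasure lam S E μ).rnDeriv ν v ≤ R) :
    eLpNorm (fun V : Fin N → XN N d => ∫ v, barronIntegrand σ (x 1) (z 0) v ∂μ -
        elmOutput σ (samplingReadout (inducedMeasure lam S E μ) ν V) V y z) 2
        (Measure.pi fun _ => ν) ≤
      ENNReal.ofReal (L * τ * firstOrderIntegral μ) +
        ENNReal.ofReal ((N : ℝ) ^ (-(1 / 2) : ℝ)) * (R ^ (1 / 2 : ℝ) *
          ENNReal.ofReal (2 * (L * (r + τ + M + 1) + |σ 0|) * secondOrderIntegral μ)) := by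
  have hr : 0 ≤ r := (norm_nonneg _).trans hx
  have hM : 0 ≤ M := (norm_nonneg _).trans hz
  have hσm : Measurable σ := hσ.continuous.measurable
  have hψ := measurable_weightMap (p := p) lam S E
  set μ' := inducedMeasure lam S E μ with hμ'
  have : IsProbabilityMeasure μ' := Measure.isProbabilityMeasure_map hψ.aemeasurable
  set h := neuron σ (y 1) (z 0) (N := N)
  have hm : Measurable h := measurable_neuron hσm _ _
  set u : X p d → ℝ := barronIntegrand σ (x 1) (z 0)
  have hum : Measurable u := measurable_barronIntegrand hσm _ _
  set κ := L * (r + τ + M + 1) + |σ 0|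
  have hκ : 0 ≤ κ := by positivity
  have hgrow : ∀ v : X p d, |h (weightMap lam S E v)| ≤
      κ * (|v.1| * (‖v.2.1‖ + ‖v.2.2.1‖ + |v.2.2.2| + 1)) := fun v => by
    simp only [h, neuron_weightMap]
    exact abs_mul_activation_le hσ hx hz hτ v (htrunc _)
  have hugrow : ∀ v : X p d, |u v| ≤
      κ * (|v.1| * (‖v.2.1‖ + ‖v.2.2.1‖ + |v.2.2.2| + 1)) := fun v =>
    abs_mul_activation_le hσ hx hz hτ v (by
      rw [sub_self, abs_zero]
      positivity)
  have hL2 : eLpNorm (fun v => h (weightMap lam S E v)) 2 μ ≤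
      ENNReal.ofReal (2 * κ * secondOrderIntegral μ) := eLpNorm_two_le_of_growth hI2 hκ hgrow
  have hmap : eLpNorm h 2 μ' ≤ ENNReal.ofReal (2 * κ * secondOrderIntegral μ) := by
    rw [hμ', inducedMeasure, eLpNorm_map_measure hm.aestronglyMeasurable hψ.aemeasurable]
    exact hL2
  have hint : ∫ v, h v ∂μ' = ∫ v, h (weightMap lam S E v) ∂μ :=
    integral_map hψ.aemeasurable hm.aestronglyMeasurable
  have hi1 : Integrable u μ :=
    (show MemLp u 2 μ from ⟨hum.aestronglyMeasurable,
      (eLpNorm_two_le_of_growth hI2 hκ hugrow).trans_lt ENNReal.ofReal_lt_top⟩).integrable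
      (by norm_num)
  have hi2 : Integrable (fun v => h (weightMap lam S E v)) μ :=
    (show MemLp (fun v => h (weightMap lam S E v)) 2 μ from
      ⟨(hm.comp hψ).aestronglyMeasurable, hL2.trans_lt ENNReal.ofReal_lt_top⟩).integrable
      (by norm_num)
  -- Replacing the system state by the network state changes the integral only through the Lipschitz
  -- constant and `τ`.
  have hbias : |∫ v, u v ∂μ - ∫ v, h v ∂μ'| ≤ L * τ * firstOrderIntegral μ := by
    rw [hint, ← integral_sub hi1 hi2, firstOrderIntegral, ← integral_const_mul]
    rw [← Real.norm_eq_abs]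
    refine norm_integral_le_of_norm_le (hI.const_mul _) (ae_of_all _ fun v => ?_)
    rw [Real.norm_eq_abs]
    simp only [u, h, neuron_weightMap, barronIntegrand]
    rw [← mul_sub, abs_mul]
    set s := inner ℝ (transferredWeight lam S E v.2.1) (y 1)
        + (-inner ℝ (transferredWeight lam S E v.2.1) E.biasSum
          + pairing v.2.1 (∑' k : ℕ, (S.A ^ k) S.B)) with hs
    have h1 := hσ.dist_le_mul (pairing v.2.1 (x 1) + inner ℝ v.2.2.1 (z 0) + v.2.2.2)
      (s + inner ℝ v.2.2.1 (z 0) + v.2.2.2)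
    rw [Real.dist_eq, Real.dist_eq, add_sub_add_right_eq_sub, add_sub_add_right_eq_sub,
      abs_sub_comm (pairing v.2.1 (x 1)) s] at h1
    calc _ ≤ |v.1| * (L * (τ * ‖v.2.1‖)) :=
          mul_le_mul_of_nonneg_left
            (h1.trans (mul_le_mul_of_nonneg_left (htrunc v.2.1) L.2)) (abs_nonneg _)
      _ = L * τ * (|v.1| * ‖v.2.1‖) := by ring
      _ ≤ L * τ * (|v.1| * (‖v.2.1‖ + ‖v.2.2.1‖ + |v.2.2.2|)) := by
          gcongr
          linarith [norm_nonneg v.2.2.1, abs_nonneg v.2.2.2]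
  have hsamp := eLpNorm_importance_sampling_le hN hac hRt hR hm
    ⟨hm.aestronglyMeasurable, hmap.trans_lt ENNReal.ofReal_lt_top⟩
  have hmeas : Measurable fun V : Fin N → XN N d =>
      ∫ v, h v ∂μ' - ∑ i, (N : ℝ)⁻¹ * ((μ'.rnDeriv ν (V i)).toReal * h (V i)) := by
    refine measurable_const.sub (Finset.measurable_sum _ fun i _ => ?_)
    have hi : Measurable fun v : XN N d => (μ'.rnDeriv ν v).toReal * h v :=
      (μ'.measurable_rnDeriv ν).ennreal_toReal.mul hm
    exact (hi.comp (measurable_pi_apply i)).const_mul _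
  have hsplit : (fun V : Fin N → XN N d => ∫ v, u v ∂μ - elmOutput σ (samplingReadout μ' ν V) V y z)
      = (fun _ => ∫ v, u v ∂μ - ∫ v, h v ∂μ') + fun V : Fin N → XN N d =>
        ∫ v, h v ∂μ' - ∑ i, (N : ℝ)⁻¹ * ((μ'.rnDeriv ν (V i)).toReal * h (V i)) := by
    funext V
    rw [elmOutput_samplingReadout, Pi.add_apply]
    ring
  rw [hsplit]
  refine (eLpNorm_add_le aestronglyMeasurable_const hmeas.aestronglyMeasurable
    (by norm_num)).trans (add_le_add ?_ (hsamp.trans (by gcongr)))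
  rw [eLpNorm_const _ (by norm_num) (IsProbabilityMeasure.ne_zero _), measure_univ,
    ENNReal.one_rpow, mul_one, Real.enorm_eq_ofReal_abs]
  exact ENNReal.ofReal_le_ofReal hbias

omit [NeZero d] in
/-- The functional itself is bounded by the second-order integral. -/
lemma abs_integral_barronIntegrand_le {σ : ℝ → ℝ} {L : ℝ≥0} (hσ : LipschitzWith L σ)
    {μ : Measure (X p d)} [IsProbabilityMeasure μ]
    (hI2 : Integrable (fun v : X p d => secondOrderIntegrand v) μ)
    {x : EllP q} {z₀ : Vec d} {r M : ℝ} (hx : ‖x‖ ≤ r) (hz : ‖z₀‖ ≤ M) :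
    |∫ v, barronIntegrand σ x z₀ v ∂μ| ≤
      2 * (L * (r + M + 1) + |σ 0|) * secondOrderIntegral μ := by
  have hr : 0 ≤ r := (norm_nonneg _).trans hx
  have hM : 0 ≤ M := (norm_nonneg _).trans hz
  set u : X p d → ℝ := barronIntegrand σ x z₀
  have hum : Measurable u := measurable_barronIntegrand hσ.continuous.measurable _ _
  have hs : 0 ≤ secondOrderIntegral μ := Real.sqrt_nonneg _
  have hgrow : ∀ v : X p d, |u v| ≤
      (L * (r + M + 1) + |σ 0|) * (|v.1| * (‖v.2.1‖ + ‖v.2.2.1‖ + |v.2.2.2| + 1)) := fun v => by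
    have := abs_mul_activation_le hσ hx hz le_rfl v (s := pairing v.2.1 x) (by simp)
    rwa [add_zero] at this
  have h2 := eLpNorm_two_le_of_growth hI2 (by positivity) hgrow
  have h1 : eLpNorm u 1 μ ≤ eLpNorm u 2 μ :=
    eLpNorm_le_eLpNorm_of_exponent_le (by norm_num) hum.aestronglyMeasurable
  have h3 : ‖∫ v, u v ∂μ‖ₑ ≤ eLpNorm u 1 μ := by
    rw [eLpNorm_one_eq_lintegral_enorm]
    exact enorm_integral_le_lintegral_enorm u
  rw [← ENNReal.ofReal_le_ofReal_iff (by positivity), ← Real.enorm_eq_ofReal_abs]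
  exact h3.trans (h1.trans h2)

/-- The leading constant of the approximation bound. -/
noncomputable def growthConst (d : ℕ) (L : ℝ≥0) (σ₀ M lam : ℝ) : ℝ :=
  L * (stateConst M lam + 2 * truncConst d M lam + M + 1) + σ₀

/-- Here `n` stands for `N^{-1/2}`, `m` for the Wasserstein factor and `t` for the minimum. Since
`m` and `t` are at least `1`, the truncation part `n` is absorbed into `n * t`; the network decay
`e` only enlarges the bound. -/
lemma error_bound_assembly {K₁ K₂ l e n m t : ℝ≥0∞} (hm : 1 ≤ m) (ht : 1 ≤ t) :
    K₁ * (l + n) + n * (m * t * K₂) ≤ (K₁ + K₂) * m * (l + e + n * t) := by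
  have h1 : l + n ≤ m * (l + e + n * t) := by
    calc l + n ≤ l + e + n * t := add_le_add le_self_add (le_mul_of_one_le_right bot_le ht)
      _ ≤ _ := le_mul_of_one_le_left bot_le hm
  have h2 : n * (m * t * K₂) ≤ K₂ * (m * (l + e + n * t)) := by
    calc n * (m * t * K₂) = K₂ * (m * (n * t)) := by ring
      _ ≤ _ := by gcongr; exact le_add_self
  calc _ ≤ K₁ * (m * (l + e + n * t)) + K₂ * (m * (l + e + n * t)) := by gcongr
    _ = _ := by ring

end Approximation

end RecurrentBarron

/-! ### Choice of the constant and the dichotomy on the network gain. -/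

open RecurrentBarron in
theorem corollary3p8 (d : ℕ) [NeZero d] (σ₂ : ℝ → ℝ) (hσ₂ : ∃ L : ℝ≥0, LipschitzWith L σ₂)
    (p q : ℝ≥0∞) [Fact (1 ≤ p)] [Fact (1 ≤ q)] (hp : 1 < p) (hp' : p < ∞)
    (hpq : ENNReal.HolderConjugate p q) (M lam : ℝ) (hlam : lam ∈ Set.Ioo (0 : ℝ) 1) :
    ∃ c₁ : ℝ, 0 < c₁ ∧
      ∀ (D : Set (Vec d)) (_ : ∀ u ∈ D, ‖u‖ ≤ M)
        (I : Set (PastSeq (Vec d))) (_ : ∀ z ∈ I, ∀ n, z n ∈ D)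
        (H : PastSeq (Vec d) → ℝ) (S : StateSystem q d)
        (μ : Measure (X p d)) (_ : IsProbabilityMeasure μ)
        (_ : IsRealization id σ₂ I H S μ)
        (_ : ‖S.A‖ < lam)
        (_ : Integrable (fun v : X p d => secondOrderIntegrand v) μ)
        (_ : Integrable (fun v : X p d => |v.1| + ‖v.2.1‖ + ‖v.2.2.1‖ + |v.2.2.2|) μ)
        (N : ℕ) (_ : 0 < N) (E : ESN N d) (_ : ‖E.A‖ < 1) (_ : IsUnit E.controllability)
        (ν₀ : Measure (XN N d)) (_ : IsProbabilityMeasure ν₀)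
        (_ : Integrable (fun v : XN N d => euclNorm v) ν₀)
        (δ : ℝ) (_ : δ ∈ Set.Ioo (0 : ℝ) 1),
        ∃ ν : Measure (XN N d), IsProbabilityMeasure ν ∧
          wasserstein1 ν₀ ν ≤ ENNReal.ofReal δ ∧
          ∃ f : (Fin N → XN N d) → (Fin N → ℝ), Measurable f ∧
            ∀ z ∈ I, (∃! x, E.IsSolution id z x) ∧
              ∀ x, E.IsSolution id z x →
                eLpNorm (fun V : Fin N → XN N d => H z - elmOutput σ₂ (f V) V x z) 2
                    (Measure.pi fun _ => ν) ≤
                  ENNReal.ofReal (approxConst c₁ lam S E μ)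
                    * (max 1 (wasserstein1 ν₀ (inducedMeasure lam S E μ))) ^ (1 / 2 : ℝ)
                    * (ENNReal.ofReal (lam ^ ((N : ℝ) / (d : ℝ)))
                      + ENNReal.ofReal (‖E.A‖ ^ ((N : ℝ) / (d : ℝ)))
                      + ENNReal.ofReal ((N : ℝ) ^ (-(1 / 2) : ℝ))
                        * min (ENNReal.ofReal (δ ^ (-(1 / 2) : ℝ)))
                            (densityBound (inducedMeasure lam S E μ) ν₀ ^ (1 / 2 : ℝ))) := by
  obtain ⟨L, hσ⟩ := hσ₂
  have := hpq
  -- A negative `M` forces `I` to be empty; the truncation at `0` keeps the constants nonnegative in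
  -- that case too.
  set M' := max M 0
  have hM' : 0 ≤ M' := le_max_right _ _
  have hsc := stateConst_nonneg hM' hlam
  have htc := truncConst_nonneg (d := d) hM' hlam
  set g := growthConst d L |σ₂ 0| M' lam with hg
  set τ₀ := truncConst d M' lam with hτ₀
  have hg0 : 0 ≤ g := by
    rw [hg, growthConst, ← hτ₀]
    positivity
  -- `L * τ₀` pays for truncation and `2 * g` for sampling; the `1` ensures positivity.
  refine ⟨L * τ₀ + 2 * g + 1, by positivity, ?_⟩
  intro D hD I hI H S μ hμ hreal hS hI2 hI1 N hN E hE hK ν₀ hν₀ hν₀1 δ hδ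
  have hzM : ∀ z ∈ I, ∀ n, ‖z n‖ ≤ M' := fun z hz n => (hD _ (hI z hz n)).trans (le_max_left _ _)
  have hψ := measurable_weightMap (p := p) lam S E
  set μ' := inducedMeasure lam S E μ with hμ'
  have hμ'p : IsProbabilityMeasure μ' := Measure.isProbabilityMeasure_map hψ.aemeasurable
  have hN' : (0 : ℝ) < N := by exact_mod_cast hN
  set G := systemGain p lam S with hGdef
  set Y := E.networkGain lam with hYdef
  have hG : 1 ≤ G := one_le_systemGain lam S
  have hY0 : 0 ≤ Y := networkGain_nonneg hE lam
  set J := max (firstOrderIntegral μ) (secondOrderIntegral μ) with hJ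
  have hJ2 : secondOrderIntegral μ ≤ J := le_max_right _ _
  have hJ1 : firstOrderIntegral μ ≤ J := le_max_left _ _
  have hs2 : 0 ≤ secondOrderIntegral μ := Real.sqrt_nonneg _
  have hs1 : 0 ≤ firstOrderIntegral μ := integral_nonneg fun v => by positivity
  have hJ0 : 0 ≤ J := hs2.trans hJ2
  set Q := G * J * (1 + Y) with hQ
  have hQ0 : 0 ≤ Q := by positivity
  have hconst : approxConst (L * τ₀ + 2 * g + 1) lam S E μ = (L * τ₀ + 2 * g + 1) * Q := by
    rw [hQ, hGdef, hYdef, hJ]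
    simp only [approxConst, systemGain, ESN.networkGain]
    ring
  have hKle : ENNReal.ofReal (L * τ₀ * Q) + ENNReal.ofReal (2 * g * Q) ≤
      ENNReal.ofReal (approxConst (L * τ₀ + 2 * g + 1) lam S E μ) := by
    rw [hconst, ← ENNReal.ofReal_add (by positivity) (by positivity)]
    exact ENNReal.ofReal_le_ofReal (by nlinarith)
  set m := (max 1 (wasserstein1 ν₀ μ')) ^ (1 / 2 : ℝ) with hm
  have hm1 : 1 ≤ m := ENNReal.one_le_rpow (le_max_left _ _) (by norm_num)
  set t := min (ENNReal.ofReal (δ ^ (-(1 / 2) : ℝ))) (densityBound μ' ν₀ ^ (1 / 2 : ℝ)) with ht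
  have ht1 : 1 ≤ t := by
    refine le_min ?_ (ENNReal.one_le_rpow (one_le_densityBound _ _) (by norm_num))
    rw [ENNReal.one_le_ofReal]
    exact Real.one_le_rpow_of_pos_of_le_one_of_nonpos hδ.1 hδ.2.le (by norm_num)
  set l := lam ^ ((N : ℝ) / (d : ℝ))
  have hl0 : 0 ≤ l := Real.rpow_nonneg hlam.1.le _
  have hl1 : l ≤ 1 := Real.rpow_le_one hlam.1.le hlam.2.le (by positivity)
  have hrpow : (N : ℝ) ^ (-(1 / 2) : ℝ) = (√N)⁻¹ := by
    rw [Real.rpow_neg hN'.le, Real.sqrt_eq_rpow]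
  set n := (N : ℝ) ^ (-(1 / 2) : ℝ)
  have hsqrt : 1 ≤ √(N : ℝ) := Real.one_le_sqrt.mpr (by exact_mod_cast hN)
  have hn0 : 0 ≤ n := by positivity
  have hn1 : n ≤ 1 := by
    rw [hrpow]
    exact inv_le_one_of_one_le₀ hsqrt
  have hstate : ∀ z ∈ I, ∀ x, S.IsSolution id z x → ‖x 1‖ ≤ stateConst M' lam * G :=
    fun z hz x hx => (norm_le_of_recursion (hS.trans hlam.2) hx.1 hx.recursion
      (norm_input_add_bias_le S.C S.B (hzM z hz)) 1).trans (state_bound_le hp' hlam hS hM')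
  by_cases hX : Y < √N
  · have hW : wasserstein1 ν₀ μ' ≠ ∞ :=
      (wasserstein1_lt_top hν₀1 (integrable_euclNorm_inducedMeasure hlam.1 hS E hI1)).ne
    obtain ⟨ν, hν, hWν, hac, R, hRt, hR, hRle⟩ := exists_reference ν₀ μ' hW hδ
    refine ⟨ν, hν, hWν, samplingReadout μ' ν, measurable_samplingReadout μ' ν, fun z hz =>
      ⟨ESN.existsUnique_isSolution hE (hzM z hz), fun y hy => ?_⟩⟩
    obtain ⟨x, hx, -⟩ := hreal.1 z hz
    have hH : H z = ∫ v, barronIntegrand σ₂ (x 1) (z 0) v ∂μ := hreal.2.2 z hz x hx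
    set τ := τ₀ * (G * (1 + Y)) * (l + n) with hτ
    have hτ0 : 0 ≤ τ := by positivity
    -- Since `l + n ≤ 2`, the truncation error is bounded uniformly in `N` relative to `G * (1 +
    -- Y)`; this is the source of `2 * truncConst` in `growthConst`.
    have hτle : τ ≤ 2 * τ₀ * (G * (1 + Y)) := by
      have : τ ≤ τ₀ * (G * (1 + Y)) * 2 := by
        rw [hτ]
        gcongr
        linarith
      linarith
    have hGY : G ≤ G * (1 + Y) := le_mul_of_one_le_right (by linarith) (by linarith)
    have hGY1 : 1 ≤ G * (1 + Y) := hG.trans hGY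
    rw [hH]
    refine (eLpNorm_samplingReadout_le hσ hN hreal.2.1 hI2 (hstate z hz x hx) (hzM z hz 0) hτ0
      (fun a => abs_transferred_sub_le_gain hp' hlam hS hN hE hK hX hM' (hzM z hz) hx hy a)
      hac hRt hR).trans ?_
    have hκ : L * (stateConst M' lam * G + τ + M' + 1) + |σ₂ 0| ≤ g * (G * (1 + Y)) := by
      have h1 : stateConst M' lam * G + τ + M' + 1 ≤
          (stateConst M' lam + 2 * τ₀ + M' + 1) * (G * (1 + Y)) := by
        have e1 : stateConst M' lam * G ≤ stateConst M' lam * (G * (1 + Y)) := by gcongr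
        have e2 : M' ≤ M' * (G * (1 + Y)) := le_mul_of_one_le_right hM' hGY1
        linarith
      have h2 : |σ₂ 0| ≤ |σ₂ 0| * (G * (1 + Y)) := le_mul_of_one_le_right (abs_nonneg _) hGY1
      have h3 := mul_le_mul_of_nonneg_left h1 L.2
      rw [hg, growthConst]
      calc _ ≤ L * ((stateConst M' lam + 2 * τ₀ + M' + 1) * (G * (1 + Y)))
            + |σ₂ 0| * (G * (1 + Y)) := add_le_add h3 h2
        _ = _ := by ring
    have b1 : L * τ * firstOrderIntegral μ ≤ L * τ₀ * Q * (l + n) := by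
      calc L * τ * firstOrderIntegral μ ≤ L * τ * J := by gcongr
        _ = _ := by rw [hτ, hQ]; ring
    have b2 : 2 * (L * (stateConst M' lam * G + τ + M' + 1) + |σ₂ 0|) * secondOrderIntegral μ ≤
        2 * g * Q := by
      calc _ ≤ 2 * (g * (G * (1 + Y))) * J := by gcongr
        _ = _ := by rw [hQ]; ring
    calc _ ≤ ENNReal.ofReal (L * τ₀ * Q) * (ENNReal.ofReal l + ENNReal.ofReal n)
          + ENNReal.ofReal n * (m * t * ENNReal.ofReal (2 * g * Q)) := by
          rw [← ENNReal.ofReal_add hl0 hn0, ← ENNReal.ofReal_mul (by positivity)]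
          gcongr
      _ ≤ _ := error_bound_assembly (e := ENNReal.ofReal (‖E.A‖ ^ ((N : ℝ) / (d : ℝ)))) hm1 ht1
      _ ≤ _ := by gcongr
  · -- The vectors `θ(a)` are only bounded by `√N ‖a‖` up to constants when `2 < p`, so the network
    -- state may be far from the system state if the gain is at least `√N`. In this range the
    -- sampling term of the bound is at least the size of `H`, and the zero readout suffices.
    refine ⟨ν₀, hν₀, by simp [wasserstein1_self], fun _ _ => 0, measurable_const, fun z hz =>
      ⟨ESN.existsUnique_isSolution hE (hzM z hz), fun y _ => ?_⟩⟩
    obtain ⟨x, hx, -⟩ := hreal.1 z hz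
    have hH : H z = ∫ v, barronIntegrand σ₂ (x 1) (z 0) v ∂μ := hreal.2.2 z hz x hx
    have hHle := abs_integral_barronIntegrand_le hσ hI2 (hstate z hz x hx) (hzM z hz 0)
    have hκ : L * (stateConst M' lam * G + M' + 1) + |σ₂ 0| ≤ g * G := by
      have h1 : stateConst M' lam * G + M' + 1 ≤
          (stateConst M' lam + 2 * τ₀ + M' + 1) * G := by
        have e2 : M' ≤ M' * G := le_mul_of_one_le_right hM' hG
        have e3 : 0 ≤ 2 * τ₀ * G := by positivity
        linarith
      have h2 : |σ₂ 0| ≤ |σ₂ 0| * G := le_mul_of_one_le_right (abs_nonneg _) hG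
      have h3 := mul_le_mul_of_nonneg_left h1 L.2
      rw [hg, growthConst]
      calc _ ≤ L * ((stateConst M' lam + 2 * τ₀ + M' + 1) * G) + |σ₂ 0| * G := add_le_add h3 h2
        _ = _ := by ring
    -- The large gain offsets `N^{-1/2}`, so the factor `1 + Y` of `Q` pays for the whole size of `H
    -- z`.
    have hYn : 1 ≤ (1 + Y) * n := by
      rw [hrpow, ← div_eq_mul_inv, le_div_iff₀ (by linarith)]
      linarith [not_lt.mp hX]
    have hHQ : |H z| ≤ n * (2 * g * Q) := by
      rw [hH]
      calc _ ≤ 2 * (g * G) * J := hHle.trans (by gcongr)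
        _ ≤ 2 * (g * G) * J * ((1 + Y) * n) := le_mul_of_one_le_right (by positivity) hYn
        _ = _ := by rw [hQ]; ring
    calc _ = ENNReal.ofReal |H z| := by
          simp only [elmOutput, zero_mul, Finset.sum_const_zero, sub_zero]
          rw [eLpNorm_const _ (by norm_num) (IsProbabilityMeasure.ne_zero _), measure_univ,
            ENNReal.one_rpow, mul_one, Real.enorm_eq_ofReal_abs]
      _ ≤ ENNReal.ofReal n * ENNReal.ofReal (2 * g * Q) := by
          rw [← ENNReal.ofReal_mul hn0]
          exact ENNReal.ofReal_le_ofReal hHQ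
      _ ≤ ENNReal.ofReal (L * τ₀ * Q) * (ENNReal.ofReal l + ENNReal.ofReal n)
          + ENNReal.ofReal n * (m * t * ENNReal.ofReal (2 * g * Q)) := by
          refine le_add_left (mul_le_mul_right ?_ _)
          exact le_mul_of_one_le_left bot_le (one_le_mul hm1 ht1)
      _ ≤ _ := error_bound_assembly (e := ENNReal.ofReal (‖E.A‖ ^ ((N : ℝ) / (d : ℝ)))) hm1 ht1
      _ ≤ _ := by gcongr
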